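/- Let $\mathbb F_q$ be a finite field, $\theta:\mathbb F_q^+\to\mathbb C^\times$ a nontrivial homomorphism, $n$ a nonnegative integer, and $[[n]]=\{(i,j):1\le i<j\le n\}$. A \emph{poset} on $[n]$ is a subset $\mathcal P\subset[[n]]$ such that $(i,j),(j,k)\in\mathcal P$ implies $(i,k)\in\mathcal P$; write $\mathcal P\trianglelefteq[[n]]$ if $(j,k)\in\mathcal P$ implies $(i,l)\in\mathcal P$ for all $1\le i\le j<k\le l\le n$. Let $\mathfrak n_{\mathcal P}$ be the algebra of $n\times n$ matrices over $\mathbb F_q$ whose nonzero entries all lie in positions of $\mathcal P$, let $U_{\mathcal P}=1+\mathfrak n_{\mathcal P}$ be the corresponding pattern group, and let $\mathfrak n_{\mathcal P}^*$ be the dual space. For $\lambda\in\mathfrak n_{\mathcal P}^*$ put $\lambda_{ij}=\lambda(e_{ij})$ if $(i,j)\in\mathcal P$ and $\lambda_{ij}=0$ otherwise, and $\operatorname{supp}(\lambda)=\{(i,j):\lambda_{ij}\ne0\}$. The group $U_{\mathcal P}$ acts on $\mathfrak n_{\mathcal P}^*$ by $g\lambda(X)=\lambda(g^{-1}X)$ and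 $\lambda g(X)=\lambda(Xg^{-1})$. The supercharacter of $U_{\mathcal P}$ indexed by $\lambda\in\mathfrak n_{\mathcal P}^*$ is $$\chi^\lambda_{\mathcal P}(g)=\frac{|U_{\mathcal P}\lambda|}{|U_{\mathcal P}\lambda U_{\mathcal P}|}\sum_{\mu\in U_{\mathcal P}\lambda U_{\mathcal P}}\theta(\mu(g-1)),\qquad g\in U_{\mathcal P}.$$ Let $\mathscr S_{\mathcal P}^*$ be the set of $\lambda\in\mathfrak n_{\mathcal P}^*$ such that $\operatorname{supp}(\lambda)$ contains at most one position in each row and in each column ($\mathbb F_q$-labeled set partitions). For $\lambda\in\mathscr S_{\mathcal P}^*$ and $\mathcal Q\in\{\mathcal P,[[n]]\}$ let $$\operatorname{coadj}^{\mathrm L}_{\mathcal Q}(\lambda)=\{(j,k)\in\mathcal P:\exists\,(i,k)\in\operatorname{supp}(\lambda)\text{ with }(i,j)\in\mathcal Q\},$$ $$\operatorname{coadj}^{\mathrm R}_{\mathcal Q}(\lambda)=\{(i,j)\in\mathcal P:\exists\,(i,k)\in\operatorname{supp}(\lambda)\text{ with }(j,k)\in\mathcal Q\},$$ $\operatorname{coadj}_{\mathcal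 Q}(\lambda)=\operatorname{coadj}^{\mathrm L}_{\mathcal Q}(\lambda)\cup\operatorname{coadj}^{\mathrm R}_{\mathcal Q}(\lambda)$, and let $\operatorname{coaux}^{\bullet}_{\mathcal P}(\lambda)=\operatorname{coadj}^{\bullet}_{[[n]]}(\lambda)\setminus\operatorname{coadj}^{\bullet}_{\mathcal P}(\lambda)$, where $\bullet$ is $\mathrm L$, $\mathrm R$ or absent. For $\eta,\mu\in\mathfrak n_{\mathcal P}^*$ define $\eta*_\lambda\mu\in\mathfrak n_{\mathcal P}^*$ by $$(\eta*_\lambda\mu)_{jk}=\eta_{jk}+\mu_{jk}+\sum_{\substack{i<j<k<l\\(i,l)\in\operatorname{supp}(\lambda)}}\eta_{jl}\,\mu_{ik}\,(\lambda_{il})^{-1},\qquad (j,k)\in\mathcal P.$$ For $\eta\in\mathfrak n_{\mathcal P}^*$ with $\operatorname{supp}(\eta)\subset\operatorname{coaux}_{\mathcal P}(\lambda)$, write $\eta=\eta_{\mathrm L}+\eta_{\mathrm R\setminus\mathrm L}$ with $\operatorname{supp}(\eta_{\mathrm L})\subset\operatorname{coaux}^{\mathrm L}_{\mathcal P}(\lambda)$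 and $\operatorname{supp}(\eta_{\mathrm R\setminus\mathrm L})\subset\operatorname{coaux}^{\mathrm R}_{\mathcal P}(\lambda)\setminus\operatorname{coaux}^{\mathrm L}_{\mathcal P}(\lambda)$, and let $\chi^{(\lambda,\eta)}_{\mathcal P}$ be the supercharacter of $U_{\mathcal P}$ indexed by $\lambda+\eta_{\mathrm L}*_\lambda\eta_{\mathrm R\setminus\mathrm L}$. \textbf{Claim.} (1) Let $\mathcal P\trianglelefteq[[n]]$, let $\lambda\in\mathscr S_{\mathcal P}^*$, and let $\eta\in\mathfrak n_{\mathcal P}^*$ have $\operatorname{supp}(\eta)\subset\operatorname{coaux}_{\mathcal P}(\lambda)$. Then $\chi^{(\lambda,\eta)}_{\mathcal P}$ is the character of an irreducible complex representation of $U_{\mathcal P}$ if and only if, for all $i<j<k<l$ with $(i,k),(j,l)\in\operatorname{supp}(\lambda)$, one has $\{(i,j),(j,k),(k,l)\}\not\subset\mathcal P$. (2) For $\lambda\in\mathscr S_{[[n]]}^*$, the supercharacter $\chi^\lambda_{[[n]]}$ is irreducible if and only if $\lambda$ is non-crossing, that is, when $1,2,\dots,n$ are arranged consecutively (at equal distances)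 on a circle, no two distinct chords joining $i$ and $j$ for $(i,j)\in\operatorname{supp}(\lambda)$ intersect inside the circle. -/

import Mathlib

noncomputable section

/-- A poset on `[n]`, i.e. a set of positions strictly above the diagonal of an `n × n` matrix
that is transitive. The index set is `Fin n`. -/
structure PatternPoset (n : ℕ) where
  carrier : Set (Fin n × Fin n)
  lt_of_mem : ∀ i j, (i, j) ∈ carrier → i < j
  trans_mem : ∀ i j k, (i, j) ∈ carrier → (j, k) ∈ carrier → (i, k) ∈ carrier

namespace PatternPoset

/-- The poset `[[n]]` of all positions above the diagonal. -/
def full (n : ℕ) : PatternPoset n where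
  carrier := {p | p.1 < p.2}
  lt_of_mem := fun _ _ h => h
  trans_mem := fun i j k (h : i < j) (h' : j < k) => lt_trans h h'

/-- `P ⊴ [[n]]`: whenever `i ≤ j < k ≤ l` and `(j, k) ∈ P`, also `(i, l) ∈ P`. -/
def IsNormal {n : ℕ} (P : PatternPoset n) : Prop :=
  ∀ i j k l : Fin n, i ≤ j → j < k → k ≤ l → (j, k) ∈ P.carrier → (i, l) ∈ P.carrier

end PatternPoset

namespace PatternGroup

open Matrix

section Algebra

variable {F : Type*} [Field F] {n : ℕ}

/-- The nilpotent algebra `𝔫_P` of matrices supported in `P`. -/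
def nil (F : Type*) [Field F] {n : ℕ} (P : PatternPoset n) :
    Submodule F (Matrix (Fin n) (Fin n) F) where
  carrier := {X | ∀ i j, X i j ≠ 0 → (i, j) ∈ P.carrier}
  add_mem' := by
    intro X Y hX hY i j h
    by_contra hc
    have h1 : X i j = 0 := by
      by_contra h1
      exact hc (hX i j h1)
    have h2 : Y i j = 0 := by
      by_contra h2
      exact hc (hY i j h2)
    exact h (by simp [h1, h2])
  zero_mem' := by
    intro i j h
    exact absurd rfl h
  smul_mem' := by
    intro c X hX i j h
    refine hX i j fun h0 => h ?_
    simp [h0]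

theorem mul_mem_nil {P : PatternPoset n} {X Y : Matrix (Fin n) (Fin n) F}
    (hX : X ∈ nil F P) (hY : Y ∈ nil F P) : X * Y ∈ nil F P := by
  intro i k h
  rw [Matrix.mul_apply] at h
  obtain ⟨j, -, hj⟩ := Finset.exists_ne_zero_of_sum_ne_zero h
  exact P.trans_mem i j k (hX i j (left_ne_zero_of_mul hj)) (hY j k (right_ne_zero_of_mul hj))

theorem one_mem_aux {P : PatternPoset n} {A B : Matrix (Fin n) (Fin n) F}
    (hA : A - 1 ∈ nil F P) (hB : B - 1 ∈ nil F P) : A * B - 1 ∈ nil F P := by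
  have h : A * B - 1 = (A - 1) * (B - 1) + (A - 1) + (B - 1) := by noncomm_ring
  rw [h]
  exact (nil F P).add_mem ((nil F P).add_mem (mul_mem_nil hA hB) hA) hB

end Algebra

variable {F : Type*} [Field F] [Finite F] {n : ℕ}

/-- The pattern group `U_P`: the invertible matrices of the form `1 + X` with `X ∈ 𝔫_P`, i.e. the
upper triangular matrices with ones on the diagonal whose other nonzero entries lie in `P`. -/
def U (F : Type*) [Field F] [Finite F] {n : ℕ} (P : PatternPoset n) :
    Subgroup (GL (Fin n) F) where
  carrier := {g | (g : Matrix (Fin n) (Fin n) F) - 1 ∈ nil F P}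
  one_mem' := by
    simp [(nil F P).zero_mem]
  mul_mem' := by
    intro a b ha hb
    exact one_mem_aux ha hb
  inv_mem' := by
    intro g hg
    have hpow : ∀ m : ℕ,
        ((g ^ m : GL (Fin n) F) : Matrix (Fin n) (Fin n) F) - 1 ∈ nil F P := by
      intro m
      induction m with
      | zero => simp [(nil F P).zero_mem]
      | succ m ih =>
        rw [pow_succ, Units.val_mul]
        exact one_mem_aux ih hg
    have : Finite (Matrix (Fin n) (Fin n) F) := inferInstanceAs (Finite (Fin n → Fin n → F))
    have : Finite (GL (Fin n) F) := inferInstanceAs (Finite (Matrix (Fin n) (Fin n) F)ˣ)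
    have hinv : g⁻¹ = g ^ (orderOf g - 1) := by
      rw [inv_eq_iff_mul_eq_one, ← pow_succ', Nat.sub_add_cancel (orderOf_pos g),
        pow_orderOf_eq_one]
    change ((g⁻¹ : GL (Fin n) F) : Matrix (Fin n) (Fin n) F) - 1 ∈ nil F P
    rw [hinv]
    exact hpow _

/-- The dual space `𝔫_P^*`. -/
abbrev NilDual (F : Type*) [Field F] {n : ℕ} (P : PatternPoset n) : Type _ :=
  Module.Dual F (nil F P)

/-- Left multiplication by `g ∈ U_P` on `𝔫_P`. -/
def mulLeft {P : PatternPoset n} (g : U F P) : nil F P →ₗ[F] nil F P where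
  toFun X := ⟨((g : GL (Fin n) F) : Matrix (Fin n) (Fin n) F) * (X : Matrix (Fin n) (Fin n) F), by
    have h : ((g : GL (Fin n) F) : Matrix (Fin n) (Fin n) F) * X.1
        = (((g : GL (Fin n) F) : Matrix (Fin n) (Fin n) F) - 1) * X.1 + X.1 := by noncomm_ring
    rw [h]
    exact (nil F P).add_mem (mul_mem_nil g.2 X.2) X.2⟩
  map_add' X Y := by
    ext1
    exact Matrix.mul_add _ _ _
  map_smul' c X := by
    ext1
    exact Matrix.mul_smul _ _ _

/-- Right multiplication by `g ∈ U_P` on `𝔫_P`. -/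
def mulRight {P : PatternPoset n} (g : U F P) : nil F P →ₗ[F] nil F P where
  toFun X := ⟨(X : Matrix (Fin n) (Fin n) F) * ((g : GL (Fin n) F) : Matrix (Fin n) (Fin n) F), by
    have h : X.1 * ((g : GL (Fin n) F) : Matrix (Fin n) (Fin n) F)
        = X.1 * (((g : GL (Fin n) F) : Matrix (Fin n) (Fin n) F) - 1) + X.1 := by noncomm_ring
    rw [h]
    exact (nil F P).add_mem (mul_mem_nil X.2 g.2) X.2⟩
  map_add' X Y := by
    ext1
    exact Matrix.add_mul _ _ _
  map_smul' c X := by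
    ext1
    exact Matrix.smul_mul _ _ _

/-- `(g λ)(X) = λ(g⁻¹ X)`. -/
def leftAct {P : PatternPoset n} (g : U F P) (lam : NilDual F P) : NilDual F P :=
  lam ∘ₗ mulLeft g⁻¹

/-- `(λ g)(X) = λ(X g⁻¹)`. -/
def rightAct {P : PatternPoset n} (lam : NilDual F P) (g : U F P) : NilDual F P :=
  lam ∘ₗ mulRight g⁻¹

/-- The left orbit `U_P λ`. -/
def leftOrbit {P : PatternPoset n} (lam : NilDual F P) : Set (NilDual F P) :=
  {mu | ∃ g : U F P, mu = leftAct g lam}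

/-- The two-sided orbit `U_P λ U_P`. -/
def twoSidedOrbit {P : PatternPoset n} (lam : NilDual F P) : Set (NilDual F P) :=
  {mu | ∃ g h : U F P, mu = rightAct (leftAct g lam) h}

/-- The element `g - 1` of `𝔫_P`, for `g ∈ U_P`. -/
def subOne {P : PatternPoset n} (g : U F P) : nil F P :=
  ⟨((g : GL (Fin n) F) : Matrix (Fin n) (Fin n) F) - 1, g.2⟩

/-- The supercharacter
`χ_P^λ(g) = |U_P λ| / |U_P λ U_P| * ∑_{μ ∈ U_P λ U_P} θ(μ(g - 1))` of `U_P`. -/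
def superchar (θ : AddChar F ℂ) {P : PatternPoset n} (lam : NilDual F P) (g : U F P) : ℂ :=
  ((leftOrbit lam).ncard : ℂ) / ((twoSidedOrbit lam).ncard : ℂ) *
    ∑ᶠ mu ∈ twoSidedOrbit lam, θ (mu (subOne g))

section Combinatorics

variable {F : Type*} [Field F] {n : ℕ} {P : PatternPoset n}

/-- The elementary matrix `e_{ij}` as an element of `𝔫_P`, for `(i, j) ∈ P`. -/
def elem (F : Type*) [Field F] {n : ℕ} {P : PatternPoset n} {i j : Fin n}
    (h : (i, j) ∈ P.carrier) : nil F P :=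
  ⟨Matrix.single i j 1, by
    intro a b hab
    by_cases hc : i = a ∧ j = b
    · obtain ⟨rfl, rfl⟩ := hc
      exact h
    · exact absurd (Matrix.single_apply_of_ne _ _ _ _ _ hc) hab⟩

open Classical in
/-- The matrix entry `λ_{ij}` of a functional: `λ(e_{ij})` if `(i, j) ∈ P`, and `0` otherwise. -/
def entry (lam : NilDual F P) (i j : Fin n) : F :=
  if h : (i, j) ∈ P.carrier then lam (elem F h) else 0

/-- `supp(λ)`, the set of positions with `λ_{ij} ≠ 0`. -/
def supp (lam : NilDual F P) : Set (Fin n × Fin n) :=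
  {p | entry lam p.1 p.2 ≠ 0}

/-- `λ ∈ 𝒮_P^*`: the support contains at most one position in each row and each column. -/
def IsLabeledSetPartition (lam : NilDual F P) : Prop :=
  (∀ i j j' : Fin n, (i, j) ∈ supp lam → (i, j') ∈ supp lam → j = j') ∧
  (∀ i i' j : Fin n, (i, j) ∈ supp lam → (i', j) ∈ supp lam → i = i')

/-- The functional on `𝔫_P` given by the matrix `f`; only the entries of `f` in positions of `P`
matter. -/
def ofEntries (P : PatternPoset n) (f : Fin n → Fin n → F) : NilDual F P where
  toFun X := ∑ i, ∑ j, f i j * (X : Matrix (Fin n) (Fin n) F) i j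
  map_add' X Y := by
    simp [mul_add, Finset.sum_add_distrib]
  map_smul' c X := by
    simp [Finset.mul_sum, mul_left_comm]

theorem entry_ofEntries (f : Fin n → Fin n → F) {i j : Fin n} (h : (i, j) ∈ P.carrier) :
    entry (ofEntries P f) i j = f i j := by
  classical
  simp only [entry, h, dite_true, ofEntries, elem, LinearMap.coe_mk, AddHom.coe_mk,
    Matrix.single_apply]
  rw [Finset.sum_eq_single i, Finset.sum_eq_single j]
  · simp
  · intro b _ hb
    simp [hb.symm]
  · simp
  · intro a _ ha
    simp [ha.symm]
  · simp

/-- `coadj_Q^L(λ) ⊆ P`. -/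
def coadjL (Q : PatternPoset n) (lam : NilDual F P) : Set (Fin n × Fin n) :=
  {p | p ∈ P.carrier ∧ ∃ i, (i, p.2) ∈ supp lam ∧ (i, p.1) ∈ Q.carrier}

/-- `coadj_Q^R(λ) ⊆ P`. -/
def coadjR (Q : PatternPoset n) (lam : NilDual F P) : Set (Fin n × Fin n) :=
  {p | p ∈ P.carrier ∧ ∃ k, (p.1, k) ∈ supp lam ∧ (p.2, k) ∈ Q.carrier}

/-- `coadj_Q(λ)`. -/
def coadj (Q : PatternPoset n) (lam : NilDual F P) : Set (Fin n × Fin n) :=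
  coadjL Q lam ∪ coadjR Q lam

/-- `coaux_P^L(λ)`. -/
def coauxL (lam : NilDual F P) : Set (Fin n × Fin n) :=
  coadjL (PatternPoset.full n) lam \ coadjL P lam

/-- `coaux_P^R(λ)`. -/
def coauxR (lam : NilDual F P) : Set (Fin n × Fin n) :=
  coadjR (PatternPoset.full n) lam \ coadjR P lam

/-- `coaux_P(λ)`. -/
def coaux (lam : NilDual F P) : Set (Fin n × Fin n) :=
  coadj (PatternPoset.full n) lam \ coadj P lam

open Classical in
/-- The functional obtained from `η` by keeping only the entries in positions of `S`. -/
def restrictTo (S : Set (Fin n × Fin n)) (eta : NilDual F P) : NilDual F P :=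
  ofEntries P fun i j => if (i, j) ∈ S then entry eta i j else 0

open Classical in
/-- The product `η *_λ μ`, whose `(j, k)` entry for `(j, k) ∈ P` is
`η_{jk} + μ_{jk} + ∑ η_{jl} μ_{ik} λ_{il}⁻¹`, the sum being over all `(i, l) ∈ supp(λ)` with
`i < j < k < l`. -/
def starProd (lam eta mu : NilDual F P) : NilDual F P :=
  ofEntries P fun j k =>
    entry eta j k + entry mu j k +
      ∑ i, ∑ l, if i < j ∧ j < k ∧ k < l ∧ (i, l) ∈ supp lam then
        entry eta j l * entry mu i k * (entry lam i l)⁻¹ else 0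

/-- `ℜ^*_λ(η) = η_L *_λ η_{R∖L}`, where `η_L` is the part of `η` in `coaux_P^L(λ)` and `η_{R∖L}` the
part of `η` in `coaux_P^R(λ) - coaux_P^L(λ)`. -/
def rMap (lam eta : NilDual F P) : NilDual F P :=
  starProd lam (restrictTo (coauxL lam) eta) (restrictTo (coauxR lam \ coauxL lam) eta)

end Combinatorics

/-- The supercharacter `χ_P^{(λ,η)}`, indexed by the functional `λ + ℜ^*_λ(η)`. -/
def supercharPair (θ : AddChar F ℂ) {P : PatternPoset n} (lam eta : NilDual F P) : U F P → ℂ :=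
  superchar θ (lam + rMap lam eta)

/-- `χ` is the character of an irreducible finite-dimensional complex representation of `G`. -/
def IsIrreducibleCharacter {G : Type*} [Group G] (χ : G → ℂ) : Prop :=
  ∃ (V : Type) (_ : AddCommGroup V) (_ : Module ℂ V) (_ : FiniteDimensional ℂ V)
    (ρ : Representation ℂ G V), ρ.IsIrreducible ∧ ∀ g, χ g = ρ.character g

/-- The `n` points `exp(2πi m / n)`, arranged consecutively on the unit circle. -/
def circlePoint {n : ℕ} (m : Fin n) : ℂ :=
  Complex.exp (2 * Real.pi * ((m : ℕ) : ℂ) / (n : ℂ) * Complex.I)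

/-- The chord joining two of these points. -/
def chord {n : ℕ} (p : Fin n × Fin n) : Set ℂ :=
  segment ℝ (circlePoint p.1) (circlePoint p.2)

/-- A set `S` of pairs `(i, j)` with `i < j` is non-crossing: when `1, …, n` are arranged
consecutively on a circle, no two different chords given by `S` meet inside the circle. -/
def IsNonCrossing {n : ℕ} (S : Set (Fin n × Fin n)) : Prop :=
  ∀ p ∈ S, ∀ p' ∈ S, p ≠ p' → chord p ∩ chord p' ∩ Metric.ball (0 : ℂ) 1 = ∅

end PatternGroup

end

/-! The supercharacter of any `λ` is a genuine character: it is afforded by a monomial module on the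
left orbit. Hence it is irreducible iff its norm is 1. Since `g ↦ g - 1` identifies `U_P` with the
vector space `𝔫_P`, orthogonality of additive characters gives the norm as `K / N²`. Here `K` counts
the pairs `(Y, Z)` with `λ(YX) = λ(XZ)` for all `X`, and `N` is the size of the left radical of the
form `(Y, X) ↦ λ(YX)`. The right radical has the same size, so pairs for which both sides vanish
already account for `N²`. Irreducibility therefore means that the spaces of functionals `λ(Y ·)` and
`λ(· Z)` meet only in 0 (`isIrreducibleCharacter_superchar_iff`).

For a labeled set partition, a common functional that is nonzero at `e_{jk}` forces `(i, k), (j, l)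
∈ supp λ` with `(i, j), (k, l) ∈ P`. Conversely such a crossing makes `λ(e_{ij} ·)` and `λ(·
e_{kl})` proportional (`trivialIntersection_iff_not_hasCrossing`).

The parameter `η` does not matter: `λ + η_L *_λ η_{R∖L}` equals `X ↦ λ(a X b)` with `a, b` in the
full unitriangular group. That group acts on `𝔫_P` from both sides because `P` is normal, and the
intersection condition is invariant under it (`trivialIntersection_add_rMap_iff`). For `P = [[n]]`
the crossing condition becomes interlacing of endpoints, which `isNonCrossing_iff` compares with
chords meeting in the open disc. -/

namespace Representation

/-! ### Irreducibility and the norm of a character -/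

section Irreducible

variable {k G V : Type*} [Field k] [Group G] [AddCommGroup V] [Module k V]

open scoped MonoidAlgebra

/-- Converse to Schur's lemma. By Maschke an invariant subspace has an invariant complement, so
projection onto it is an intertwiner, hence a scalar. If the subspace is nonzero, this scalar fixes
a nonzero vector, so it is 1 and the subspace is everything. -/
theorem isIrreducible_of_finrank_intertwiningMap_eq_one [Finite G] [NeZero (Nat.card G : k)]
    (ρ : Representation k G V) (h : Module.finrank k (IntertwiningMap ρ ρ) = 1) :
    ρ.IsIrreducible := by
  rw [irreducible_iff_isSimpleModule_asModule]
  have hss : IsSemisimpleModule k[G] ρ.asModule :=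
    (isSemisimpleRepresentation_iff_isSemisimpleModule_asModule ρ).1 inferInstance
  have hne : (IntertwiningMap.id ρ) ≠ 0 := by
    intro h0
    have : Subsingleton (IntertwiningMap ρ ρ) := by
      refine subsingleton_of_forall_eq 0 fun f => ?_
      ext v
      have := congrArg (fun e : IntertwiningMap ρ ρ => f (e v)) h0
      simpa using this
    rw [Module.finrank_zero_of_subsingleton] at h
    exact zero_ne_one h
  have hscalar := (finrank_eq_one_iff_of_nonzero' _ hne).1 h
  have hnt : Nontrivial ρ.asModule := by
    by_contra hn
    rw [not_nontrivial_iff_subsingleton] at hn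
    apply hne
    ext v
    exact hn.elim (α := ρ.asModule) _ _
  rw [isSimpleModule_iff]
  refine { exists_pair_ne := exists_pair_ne _, eq_bot_or_eq_top := fun N => ?_ }
  obtain ⟨N', hN⟩ := exists_isCompl N
  obtain ⟨c, hc⟩ := hscalar ((IntertwiningMap.equivLinearMapAsModule ρ ρ).symm (N.projection N' hN))
  have hc' : ∀ v : V, c • v = (show V from N.projection N' hN (show ρ.asModule from v)) := by
    intro v
    have := congrArg (fun e : IntertwiningMap ρ ρ => e v) hc
    exact this
  rcases eq_or_ne N ⊥ with hb | hb
  · exact Or.inl hb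
  right
  obtain ⟨x, hx, hx0⟩ := N.ne_bot_iff.1 hb
  have h1 : c • (show V from x) = (show V from x) := by
    rw [hc']
    exact Submodule.projection_apply_left hN ⟨x, hx⟩
  have hc1 : c = 1 := by
    by_contra hcn
    have : (c - 1) • (show V from x) = 0 := by rw [sub_smul, h1, one_smul, sub_self]
    rcases smul_eq_zero.1 this with h2 | h2
    · exact hcn (sub_eq_zero.1 h2)
    · exact hx0 h2
  rw [eq_top_iff]
  intro v _
  have hv : N.projection N' hN v = v := (hc' v).symm.trans
    ((congrArg (fun r : k => r • (show V from v)) hc1).trans (one_smul k (show V from v)))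
  rw [← hv]
  exact Submodule.projection_apply_mem hN v

theorem isIrreducible_iff_sum_character [Fintype G] [IsAlgClosed k] [CharZero k]
    [FiniteDimensional k V] (ρ : Representation k G V) :
    ρ.IsIrreducible ↔ ∑ g : G, ρ.character g * ρ.character g⁻¹ = Nat.card G := by
  have hG : (Nat.card G : k) ≠ 0 := by simp
  have : NeZero (Nat.card G : k) := ⟨hG⟩
  have := invertibleOfNonzero hG
  have key := card_inv_mul_sum_char_mul_char_eq_finrank ρ ρ
  constructor
  · intro h
    rw [IsIrreducible.finrank_intertwiningMap_self, Nat.cast_one, inv_mul_eq_one₀ hG] at key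
    exact key.symm
  · intro h
    rw [h, inv_mul_cancel₀ hG] at key
    exact isIrreducible_of_finrank_intertwiningMap_eq_one ρ (by exact_mod_cast key.symm)

end Irreducible

/-! ### Monomial representations -/

section Monomial

variable {k G S : Type*} [Field k] [Group G]

/-- The monomial representation on functions `S → k` attached to an action of `G` on `S` and a
multiplicative cocycle `c`. -/
def monomial (a : G → S → S) (c : G → S → k) (a_one : ∀ s, a 1 s = s)
    (a_mul : ∀ g h s, a (g * h) s = a g (a h s)) (c_one : ∀ s, c 1 s = 1)
    (c_mul : ∀ g h s, c (g * h) s = c g (a h s) * c h s) : Representation k G (S → k) where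
  toFun g :=
    { toFun := fun f s => c g (a g⁻¹ s) * f (a g⁻¹ s)
      map_add' := fun f f' => by ext s; simp [mul_add]
      map_smul' := fun r f => by ext s; simp [mul_left_comm] }
  map_one' := by
    ext1 f
    ext s
    simp [a_one, c_one]
  map_mul' g h := by
    ext1 f
    ext s
    simp only [LinearMap.coe_mk, AddHom.coe_mk, Module.End.mul_apply, mul_inv_rev, a_mul, c_mul]
    rw [← a_mul h h⁻¹, mul_inv_cancel, a_one, mul_assoc]

theorem character_monomial [Fintype S] [DecidableEq S] (a : G → S → S) (c : G → S → k)
    (a_one : ∀ s, a 1 s = s) (a_mul : ∀ g h s, a (g * h) s = a g (a h s))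
    (c_one : ∀ s, c 1 s = 1) (c_mul : ∀ g h s, c (g * h) s = c g (a h s) * c h s) (g : G) :
    (monomial a c a_one a_mul c_one c_mul).character g =
      ∑ s, if a g s = s then c g s else 0 := by
  rw [character, LinearMap.trace_eq_matrix_trace k (Pi.basisFun k S), Matrix.trace]
  refine Finset.sum_congr rfl fun s _ => ?_
  rw [Matrix.diag_apply, LinearMap.toMatrix_apply]
  -- The diagonal entry at `s` is expressed through `g⁻¹ s`; it is nonzero only at fixed points,
  -- which are the same for `g` and `g⁻¹`.
  have hs : a g⁻¹ s = s ↔ a g s = s := by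
    constructor
    · intro h
      conv_lhs => rw [← h, ← a_mul, mul_inv_cancel, a_one]
    · intro h
      conv_lhs => rw [← h, ← a_mul, inv_mul_cancel, a_one]
  simp only [Pi.basisFun_apply, Pi.basisFun_repr, monomial, MonoidHom.coe_mk, OneHom.coe_mk,
    LinearMap.coe_mk, AddHom.coe_mk, Pi.single_apply, hs]
  split_ifs with h
  · rw [hs.2 h, mul_one]
  · rw [mul_zero]

end Monomial

end Representation

/-! ### The norm criterion, and orbit sums as group sums -/

namespace PatternGroup

theorem isIrreducibleCharacter_iff_sum {G V : Type*} [Group G] [Fintype G] [AddCommGroup V]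
    [Module ℂ V] [FiniteDimensional ℂ V] (χ : G → ℂ) (ρ : Representation ℂ G V)
    (h : ∀ g, χ g = ρ.character g) :
    IsIrreducibleCharacter χ ↔ ∑ g : G, χ g * χ g⁻¹ = Nat.card G := by
  constructor
  · rintro ⟨W, _, _, _, σ, hσ, hχ⟩
    simp only [hχ]
    exact (Representation.isIrreducible_iff_sum_character σ).1 hσ
  · intro hsum
    -- The definition asks for a space in `Type`, while `V` may live in any universe; coordinates
    -- bring it down.
    let e : V ≃ₗ[ℂ] (Fin (Module.finrank ℂ V) → ℂ) := (Module.finBasis ℂ V).equivFun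
    let σ : Representation ℂ G (Fin (Module.finrank ℂ V) → ℂ) :=
      (e.conjRingEquiv : Module.End ℂ V →* _).comp ρ
    have hσ : ∀ g, χ g = σ.character g := fun g =>
      (h g).trans (LinearMap.trace_conj' (ρ g) e).symm
    refine ⟨_, _, _, inferInstance, σ, ?_, hσ⟩
    rw [Representation.isIrreducible_iff_sum_character]
    simpa only [hσ] using hsum

/-- Applied to orbit maps, whose fibres all have the size of the stabiliser. -/
theorem sum_comp_eq_of_card_fiber {H α : Type*} [Fintype H] (φ : H → α) (N : ℕ)
    (hN : ∀ h, Nat.card {h' // φ h' = φ h} = N) (f : α → ℂ) :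
    ∑ h, f (φ h) = N * ∑ᶠ s ∈ Set.range φ, f s := by
  classical
  have hfin : (Set.range φ).Finite := Set.finite_range φ
  rw [finsum_mem_eq_finite_toFinset_sum _ hfin, Finset.mul_sum,
    ← Finset.sum_fiberwise_of_maps_to (s := Finset.univ) (t := hfin.toFinset) (g := φ)
      (fun h _ => by simp)]
  refine Finset.sum_congr rfl fun s hs => ?_
  obtain ⟨h, rfl⟩ : s ∈ Set.range φ := by simpa using hs
  rw [Finset.sum_congr rfl (g := fun _ => f (φ h))
    (fun x hx => by rw [(Finset.mem_filter.1 hx).2]), Finset.sum_const, nsmul_eq_mul, ← hN h,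
    Nat.card_eq_fintype_card, Fintype.card_subtype]

theorem card_eq_of_card_fiber {H α : Type*} [Fintype H] (φ : H → α) (N : ℕ)
    (hN : ∀ h, Nat.card {h' // φ h' = φ h} = N) :
    (Nat.card H : ℂ) = N * (Set.range φ).ncard := by
  have h := sum_comp_eq_of_card_fiber φ N hN (fun _ => 1)
  have hfin : (Set.range φ).Finite := Set.finite_range φ
  rw [finsum_mem_eq_finite_toFinset_sum _ hfin] at h
  simpa [Set.ncard_eq_toFinset_card _ hfin] using h

end PatternGroup

namespace PatternGroup

/-! ### The bilinear form `λ(YX)` and its radicals -/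

section NilMul

variable {F : Type*} [Field F] {n : ℕ} {P : PatternPoset n}

/-- Multiplication of the algebra `𝔫_P`, as a bilinear map. -/
def nilMul : nil F P →ₗ[F] nil F P →ₗ[F] nil F P :=
  LinearMap.mk₂ F (fun X Y => ⟨X.1 * Y.1, mul_mem_nil X.2 Y.2⟩)
    (fun _ _ _ => Subtype.ext (Matrix.add_mul _ _ _))
    (fun _ _ _ => Subtype.ext (Matrix.smul_mul _ _ _))
    (fun _ _ _ => Subtype.ext (Matrix.mul_add _ _ _))
    (fun _ _ _ => Subtype.ext (Matrix.mul_smul _ _ _))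

theorem coe_nilMul (X Y : nil F P) :
    (nilMul X Y : Matrix (Fin n) (Fin n) F) = X.1 * Y.1 := rfl

/-- The left and right tangent spaces `λ(𝔫 ·)` and `λ(· 𝔫)` of the one-sided orbits of `λ`
intersect trivially. -/
def TrivialIntersection (lam : NilDual F P) : Prop :=
  ∀ Y Z : nil F P, (∀ X, lam (nilMul Y X) = lam (nilMul X Z)) → ∀ X, lam (nilMul Y X) = 0

theorem apply_eq_zero_of_not_lt (X : nil F P) {i j : Fin n} (h : ¬ i < j) : X.1 i j = 0 := by
  by_contra h0
  exact h (P.lt_of_mem _ _ (X.2 i j h0))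

theorem det_one_add (X : nil F P) : (1 + X.1).det = 1 := by
  rw [Matrix.det_of_isUpperTriangular]
  · refine Finset.prod_eq_one fun i _ => ?_
    rw [Matrix.add_apply, Matrix.one_apply_eq, apply_eq_zero_of_not_lt X (lt_irrefl i), add_zero]
  · intro i j hij
    have hij' : j < i := hij
    rw [Matrix.add_apply, Matrix.one_apply_ne hij'.ne', apply_eq_zero_of_not_lt X hij'.not_gt,
      add_zero]

instance [Finite F] : Finite (nil F P) :=
  have : Finite (Matrix (Fin n) (Fin n) F) := inferInstanceAs (Finite (Fin n → Fin n → F))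
  inferInstance

instance [Finite F] : Finite (NilDual F P) :=
  Finite.of_injective (fun f : NilDual F P => (f : nil F P → F)) DFunLike.coe_injective

/-- `λ ↦ λ(Y X)` as a bilinear form on `𝔫_P`. -/
def nilForm (lam : NilDual F P) : nil F P →ₗ[F] Module.Dual F (nil F P) :=
  nilMul.compr₂ lam

@[simp]
theorem nilForm_apply (lam : NilDual F P) (X Y : nil F P) :
    nilForm lam X Y = lam (nilMul X Y) := rfl

/-- Row rank equals column rank: up to the identification of `V` with its bidual, the flipped form
is the dual map of `B`. -/
theorem finrank_ker_flip {V : Type*} [AddCommGroup V] [Module F V] [FiniteDimensional F V]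
    (B : V →ₗ[F] Module.Dual F V) :
    Module.finrank F (LinearMap.ker B.flip) = Module.finrank F (LinearMap.ker B) := by
  let C : V →ₗ[F] Module.Dual F V := B.flip
  have h1 := C.finrank_range_add_finrank_ker
  have h2 := B.finrank_range_add_finrank_ker
  have h3 : LinearMap.range C = LinearMap.range B.dualMap := by
    have : C = B.dualMap ∘ₗ (Module.evalEquiv F V).toLinearMap := by
      ext x y
      rfl
    rw [this, LinearEquiv.range_comp]
  have h4 := LinearMap.finrank_range_dualMap_eq_finrank_range B
  rw [← h3] at h4
  change Module.finrank F (LinearMap.ker C) = _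
  omega

theorem card_ker_flip [Finite F] {V : Type*} [AddCommGroup V] [Module F V]
    [FiniteDimensional F V] (B : V →ₗ[F] Module.Dual F V) :
    Nat.card (LinearMap.ker B.flip) = Nat.card (LinearMap.ker B) := by
  rw [Module.natCard_eq_pow_finrank (K := F), finrank_ker_flip,
    ← Module.natCard_eq_pow_finrank (K := F)]

/-- The product of the left and right radicals always lies in the set of pairs counted here and has
cardinality `N²`. Equality of cardinalities is thus equality of sets. -/
theorem card_eq_sq_iff_trivialIntersection [Finite F] (lam : NilDual F P) :
    Nat.card {p : nil F P × nil F P // ∀ X, lam (nilMul p.1 X) = lam (nilMul X p.2)} =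
      Nat.card (LinearMap.ker (nilForm lam)) ^ 2 ↔ TrivialIntersection lam := by
  have hsub : (LinearMap.ker (nilForm lam) : Set (nil F P)) ×ˢ
      (LinearMap.ker (nilForm lam).flip : Set (nil F P)) ⊆
      {p : nil F P × nil F P | ∀ X, lam (nilMul p.1 X) = lam (nilMul X p.2)} := by
    rintro ⟨Y, Z⟩ ⟨hY, hZ⟩ X
    have h1 : nilForm lam Y X = 0 := by rw [LinearMap.mem_ker.1 hY]; rfl
    have h2 : (nilForm lam).flip Z X = 0 := by rw [LinearMap.mem_ker.1 hZ]; rfl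
    exact h1.trans h2.symm
  have hcard : ((LinearMap.ker (nilForm lam) : Set (nil F P)) ×ˢ
      (LinearMap.ker (nilForm lam).flip : Set (nil F P))).ncard =
      Nat.card (LinearMap.ker (nilForm lam)) ^ 2 := by
    rw [Set.ncard_prod, sq, ← Nat.card_coe_set_eq, ← Nat.card_coe_set_eq]
    congr 1
    exact card_ker_flip _
  change Set.ncard {p : nil F P × nil F P | ∀ X, lam (nilMul p.1 X) = lam (nilMul X p.2)} = _ ↔ _
  rw [← hcard]
  constructor
  · intro h Y Z hYZ X
    have heq := Set.eq_of_subset_of_ncard_le hsub h.le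
    have hm : (Y, Z) ∈ {p : nil F P × nil F P | ∀ X, lam (nilMul p.1 X) = lam (nilMul X p.2)} :=
      hYZ
    rw [← heq] at hm
    exact LinearMap.congr_fun (LinearMap.mem_ker.1 hm.1) X
  · intro h
    congr 1
    refine Set.Subset.antisymm ?_ hsub
    rintro ⟨Y, Z⟩ hYZ
    have h0 := h Y Z hYZ
    refine ⟨LinearMap.mem_ker.2 (LinearMap.ext h0), LinearMap.mem_ker.2 (LinearMap.ext fun X => ?_)⟩
    exact (hYZ X).symm.trans (h0 X)

theorem sum_addChar_dual {V : Type*} [AddCommGroup V] [Module F V] [Fintype V]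
    (θ : AddChar F ℂ) (hθ : θ ≠ 1) (f : Module.Dual F V) [Decidable (f = 0)] :
    ∑ X, θ (f X) = if f = 0 then (Nat.card V : ℂ) else 0 := by
  split_ifs with h
  · simp [h]
  · have hne : θ.compAddMonoidHom f.toAddMonoidHom ≠ 0 := by
      intro h0
      apply hθ
      ext x
      obtain ⟨X, rfl⟩ := LinearMap.surjective h x
      exact DFunLike.congr_fun h0 X
    exact AddChar.sum_eq_zero_iff_ne_zero.2 hne

end NilMul

/-! ### The supercharacter as a character, and its norm -/

section Group

variable {F : Type*} [Field F] [Finite F] {n : ℕ} {P : PatternPoset n}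

theorem subOne_bijective : Function.Bijective (subOne : U F P → nil F P) := by
  constructor
  · intro g h hgh
    have h1 := congrArg (Subtype.val : nil F P → Matrix (Fin n) (Fin n) F) hgh
    exact Subtype.ext (Units.ext (sub_left_injective h1))
  · intro X
    let A : GL (Fin n) F := Matrix.nonsingInvUnit (1 + X.1) (by rw [det_one_add]; exact isUnit_one)
    have hA : (A : Matrix (Fin n) (Fin n) F) - 1 = X.1 := add_sub_cancel_left _ _
    exact ⟨⟨A, show (A : Matrix (Fin n) (Fin n) F) - 1 ∈ nil F P by rw [hA]; exact X.2⟩,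
      Subtype.ext hA⟩

theorem card_U : Nat.card (U F P) = Nat.card (nil F P) :=
  Nat.card_congr (Equiv.ofBijective _ subOne_bijective)

theorem mulLeft_apply (g : U F P) (X : nil F P) : mulLeft g X = X + nilMul (subOne g) X := by
  ext1
  change g.1.1 * X.1 = X.1 + (g.1.1 - 1) * X.1
  noncomm_ring

theorem mulRight_apply (g : U F P) (X : nil F P) : mulRight g X = X + nilMul X (subOne g) := by
  ext1
  change X.1 * g.1.1 = X.1 + X.1 * (g.1.1 - 1)
  noncomm_ring

theorem mulLeft_mul (g h : U F P) (X : nil F P) : mulLeft (g * h) X = mulLeft g (mulLeft h X) :=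
  Subtype.ext (Matrix.mul_assoc _ _ _)

theorem mulRight_mul (g h : U F P) (X : nil F P) :
    mulRight (g * h) X = mulRight h (mulRight g X) :=
  Subtype.ext (Matrix.mul_assoc _ _ _).symm

theorem mulLeft_mulRight (g h : U F P) (X : nil F P) :
    mulLeft g (mulRight h X) = mulRight h (mulLeft g X) :=
  Subtype.ext (Matrix.mul_assoc _ _ _).symm

@[simp]
theorem mulLeft_one (X : nil F P) : mulLeft 1 X = X := Subtype.ext (Matrix.one_mul _)

@[simp]
theorem mulRight_one (X : nil F P) : mulRight 1 X = X := Subtype.ext (Matrix.mul_one _)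

@[simp]
theorem mulLeft_mulLeft_inv (g : U F P) (X : nil F P) : mulLeft g (mulLeft g⁻¹ X) = X := by
  rw [← mulLeft_mul, mul_inv_cancel, mulLeft_one]

@[simp]
theorem mulLeft_inv_mulLeft (g : U F P) (X : nil F P) : mulLeft g⁻¹ (mulLeft g X) = X := by
  rw [← mulLeft_mul, inv_mul_cancel, mulLeft_one]

@[simp]
theorem mulRight_mulRight_inv (g : U F P) (X : nil F P) : mulRight g (mulRight g⁻¹ X) = X := by
  rw [← mulRight_mul, inv_mul_cancel, mulRight_one]

@[simp]
theorem mulRight_inv_mulRight (g : U F P) (X : nil F P) : mulRight g⁻¹ (mulRight g X) = X := by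
  rw [← mulRight_mul, mul_inv_cancel, mulRight_one]

theorem subOne_mul (g h : U F P) : subOne (g * h) = subOne g + mulLeft g (subOne h) := by
  ext1
  change g.1.1 * h.1.1 - 1 = (g.1.1 - 1) + g.1.1 * (h.1.1 - 1)
  noncomm_ring

theorem subOne_one : subOne (1 : U F P) = 0 := Subtype.ext (sub_self _)

theorem subOne_inv (g : U F P) : subOne g⁻¹ = - mulLeft g⁻¹ (subOne g) := by
  rw [eq_neg_iff_add_eq_zero, ← subOne_mul, inv_mul_cancel, subOne_one]

/-- The functional `X ↦ λ(a X)`. -/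
def leftTranslate (lam : NilDual F P) (a : U F P) : NilDual F P := lam ∘ₗ mulLeft a

/-- The functional `X ↦ λ(a X b)`. -/
def translate (lam : NilDual F P) (p : U F P × U F P) : NilDual F P :=
  lam ∘ₗ mulLeft p.1 ∘ₗ mulRight p.2

theorem range_leftTranslate (lam : NilDual F P) :
    Set.range (leftTranslate lam) = leftOrbit lam := by
  ext mu
  constructor
  · rintro ⟨a, rfl⟩
    exact ⟨a⁻¹, by rw [leftAct, inv_inv]; rfl⟩
  · rintro ⟨g, rfl⟩
    exact ⟨g⁻¹, rfl⟩

theorem range_translate (lam : NilDual F P) :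
    Set.range (translate lam) = twoSidedOrbit lam := by
  ext mu
  constructor
  · rintro ⟨⟨a, b⟩, rfl⟩
    exact ⟨a⁻¹, b⁻¹, by rw [leftAct, rightAct, inv_inv, inv_inv]; rfl⟩
  · rintro ⟨g, h, rfl⟩
    exact ⟨(g⁻¹, h⁻¹), rfl⟩

theorem leftTranslate_eq_self_iff (lam : NilDual F P) (a : U F P) :
    leftTranslate lam a = lam ↔ nilForm lam (subOne a) = 0 := by
  rw [LinearMap.ext_iff, LinearMap.ext_iff]
  refine forall_congr' fun X => ?_
  simp [leftTranslate, mulLeft_apply]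

/-- Right multiplication by `a⁻¹` carries the fibre to the stabiliser of `λ`, which `g ↦ g - 1` maps
onto the left radical. -/
theorem card_fiber_leftTranslate (lam : NilDual F P) (a : U F P) :
    Nat.card {a' // leftTranslate lam a' = leftTranslate lam a} =
      Nat.card (LinearMap.ker (nilForm lam)) := by
  have h1 : Nat.card {a' // leftTranslate lam a' = leftTranslate lam a} =
      Nat.card {a' // leftTranslate lam a' = lam} := by
    refine Nat.card_congr (Equiv.subtypeEquiv (Equiv.mulRight a⁻¹) fun a' => ?_)
    rw [LinearMap.ext_iff, LinearMap.ext_iff]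
    simp only [leftTranslate, LinearMap.comp_apply, Equiv.coe_mulRight, mulLeft_mul]
    constructor
    · intro h X
      simpa using h (mulLeft a⁻¹ X)
    · intro h X
      simpa using h (mulLeft a X)
  rw [h1]
  exact Nat.card_congr (Equiv.subtypeEquiv (Equiv.ofBijective _ subOne_bijective)
    fun a' => leftTranslate_eq_self_iff lam a')

theorem card_fiber_translate (lam : NilDual F P) (p : U F P × U F P) :
    Nat.card {p' // translate lam p' = translate lam p} =
      Nat.card {p : nil F P × nil F P // ∀ X, lam (nilMul p.1 X) = lam (nilMul X p.2)} := by
  have h1 : Nat.card {p' // translate lam p' = translate lam p} =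
      Nat.card {p' // translate lam p' = lam} := by
    refine Nat.card_congr (Equiv.subtypeEquiv
      ((Equiv.mulRight p.1⁻¹).prodCongr (Equiv.mulLeft p.2⁻¹)) fun p' => ?_)
    rw [LinearMap.ext_iff, LinearMap.ext_iff]
    simp only [translate, LinearMap.comp_apply, Equiv.prodCongr_apply, Prod.map_fst, Prod.map_snd,
      Equiv.coe_mulRight, Equiv.coe_mulLeft, mulLeft_mul, mulRight_mul]
    constructor
    · intro h X
      have := h (mulLeft p.1⁻¹ (mulRight p.2⁻¹ X))
      simpa [mulLeft_mulRight] using this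
    · intro h X
      have := h (mulLeft p.1 (mulRight p.2 X))
      simpa [mulLeft_mulRight] using this
  rw [h1]
  -- The stabiliser condition `λ(aXb) = λ(X)` is equivalent to `λ(aX) = λ(Xb⁻¹)`, so the second
  -- variable is `Z = b⁻¹ - 1`, not `b - 1`.
  refine Nat.card_congr (Equiv.subtypeEquiv ((Equiv.ofBijective _ subOne_bijective).prodCongr
    ((Equiv.inv _).trans (Equiv.ofBijective _ subOne_bijective))) fun q => ?_)
  rw [LinearMap.ext_iff]
  simp only [translate, LinearMap.comp_apply, Equiv.prodCongr_apply, Prod.map_fst, Prod.map_snd,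
    Equiv.trans_apply, Equiv.ofBijective_apply, Equiv.inv_apply]
  have h2 : ∀ X, lam (nilMul (subOne q.1) X) = lam (nilMul X (subOne q.2⁻¹)) ↔
      lam (mulLeft q.1 X) = lam (mulRight q.2⁻¹ X) := by
    intro X
    simp [mulLeft_apply, mulRight_apply]
  simp only [h2]
  constructor
  · intro h X
    simpa using h (mulRight q.2⁻¹ X)
  · intro h X
    simpa using h (mulRight q.2 X)

theorem leftAct_eq_self_iff (mu : NilDual F P) (g : U F P) :
    leftAct g mu = mu ↔ nilForm mu (subOne g) = 0 := by
  rw [← leftTranslate_eq_self_iff, LinearMap.ext_iff, LinearMap.ext_iff]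
  constructor
  · intro h X
    have := h (mulLeft g X)
    simp only [leftAct, LinearMap.comp_apply, mulLeft_inv_mulLeft] at this
    exact this.symm
  · intro h X
    have := h (mulLeft g⁻¹ X)
    simp only [leftTranslate, LinearMap.comp_apply, mulLeft_mulLeft_inv] at this
    exact this.symm

theorem leftAct_mul (g h : U F P) (mu : NilDual F P) :
    leftAct (g * h) mu = leftAct g (leftAct h mu) := by
  ext1 X
  simp [leftAct, mulLeft_mul]

theorem leftAct_one (mu : NilDual F P) : leftAct 1 mu = mu := by
  ext1 X
  simp [leftAct]

theorem leftAct_mem_leftOrbit {lam mu : NilDual F P} (g : U F P) (h : mu ∈ leftOrbit lam) :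
    leftAct g mu ∈ leftOrbit lam := by
  obtain ⟨a, rfl⟩ := h
  exact ⟨g * a, (leftAct_mul g a lam).symm⟩

/-- The left module with basis indexed by the left orbit of `λ`, whose character is `χ^λ`. -/
noncomputable def supercharRep (θ : AddChar F ℂ) (lam : NilDual F P) :
    Representation ℂ (U F P) (leftOrbit lam → ℂ) :=
  Representation.monomial
    (fun g mu => ⟨leftAct g mu.1, leftAct_mem_leftOrbit g mu.2⟩)
    (fun g mu => θ (leftAct g mu.1 (subOne g)))
    (fun mu => Subtype.ext (leftAct_one _))
    (fun g h mu => Subtype.ext (leftAct_mul _ _ _))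
    (fun mu => by rw [subOne_one, map_zero, AddChar.map_zero_eq_one])
    -- Cocycle identity: split `gh - 1 = (g - 1) + g(h - 1)` and note `(ghμ)(g(h - 1)) = (hμ)(h -
    -- 1)`.
    (fun g h mu => by
      rw [← AddChar.map_add_eq_mul, subOne_mul, map_add, leftAct_mul]
      congr 2
      simp [leftAct])

variable [Fintype (U F P)]

theorem card_U_eq_mul_leftOrbit (lam : NilDual F P) :
    (Nat.card (U F P) : ℂ) =
      Nat.card (LinearMap.ker (nilForm lam)) * (leftOrbit lam).ncard := by
  rw [← range_leftTranslate]
  exact card_eq_of_card_fiber _ _ (card_fiber_leftTranslate lam)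

theorem superchar_eq_sum (θ : AddChar F ℂ) (lam : NilDual F P) (g : U F P) :
    superchar θ lam g = ((leftOrbit lam).ncard : ℂ) / (Nat.card (U F P) : ℂ) ^ 2 *
      ∑ p, θ (translate lam p (subOne g)) := by
  have h1 := sum_comp_eq_of_card_fiber _ _ (card_fiber_translate lam)
    (fun mu => θ (mu (subOne g)))
  have h2 := card_eq_of_card_fiber _ _ (card_fiber_translate lam)
  rw [range_translate] at h1 h2
  rw [Nat.card_prod, Nat.cast_mul] at h2
  have hG : (Nat.card (U F P) : ℂ) ≠ 0 := by simp
  have h3 := mul_ne_zero hG hG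
  rw [h2] at h3
  have h4 := left_ne_zero_of_mul h3
  have h5 := right_ne_zero_of_mul h3
  rw [superchar, h1, sq, h2]
  field_simp

/-- Write `λ(aXb) = λ(aX) + λ(aX(b - 1))`. As `b - 1` runs over all of `𝔫_P`, the second term gives
a complete additive character sum. -/
theorem sum_translate_right (θ : AddChar F ℂ) (hθ : θ ≠ 1) (lam : NilDual F P) (a : U F P)
    (X : nil F P) [Decidable (nilForm (leftTranslate lam a) X = 0)] :
    ∑ b, θ (translate lam (a, b) X) =
      if nilForm (leftTranslate lam a) X = 0 then
        (Nat.card (U F P) : ℂ) * θ (leftTranslate lam a X) else 0 := by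
  have : Fintype (nil F P) := Fintype.ofFinite _
  have h : ∀ b, θ (translate lam (a, b) X) =
      θ (leftTranslate lam a X) * θ (nilForm (leftTranslate lam a) X (subOne b)) := by
    intro b
    rw [← AddChar.map_add_eq_mul, nilForm_apply, ← map_add, ← mulRight_apply]
    rfl
  simp only [h]
  rw [← Finset.mul_sum, Function.Bijective.sum_comp subOne_bijective
    (fun Z => θ (nilForm (leftTranslate lam a) X Z)), sum_addChar_dual θ hθ, card_U]
  split_ifs
  · exact mul_comm _ _
  · exact mul_zero _

open Classical in
-- Summing over the right factor first leaves the `μ` in the left orbit with `μ((g - 1) ·) = 0`,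
-- that is, those fixed by `g`. This is the trace formula for the monomial module.
theorem superchar_eq_sum_fixed (θ : AddChar F ℂ) (hθ : θ ≠ 1) (lam : NilDual F P)
    [Fintype (leftOrbit lam)] (g : U F P) :
    superchar θ lam g = ∑ mu : leftOrbit lam,
      if leftAct g mu.1 = mu.1 then θ (mu.1 (subOne g)) else 0 := by
  have hG : (Nat.card (U F P) : ℂ) ≠ 0 := by simp
  have h1 := sum_comp_eq_of_card_fiber _ _ (card_fiber_leftTranslate lam)
    (fun mu => if nilForm mu (subOne g) = 0 then
        (Nat.card (U F P) : ℂ) * θ (mu (subOne g)) else 0)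
  rw [range_leftTranslate, ← finsum_set_coe_eq_finsum_mem, finsum_eq_sum_of_fintype] at h1
  have h2 := card_U_eq_mul_leftOrbit lam
  rw [superchar_eq_sum, Fintype.sum_prod_type]
  simp only [sum_translate_right θ hθ, h1]
  have h3 : ∀ mu : leftOrbit lam, (if nilForm mu.1 (subOne g) = 0 then
        (Nat.card (U F P) : ℂ) * θ (mu.1 (subOne g)) else 0) = (Nat.card (U F P) : ℂ) *
        if leftAct g mu.1 = mu.1 then θ (mu.1 (subOne g)) else 0 := by
    intro mu
    rw [leftAct_eq_self_iff, mul_ite, mul_zero]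
  simp only [h3]
  rw [← Finset.mul_sum, ← mul_assoc, ← mul_assoc]
  rw [show ((leftOrbit lam).ncard : ℂ) / (Nat.card (U F P) : ℂ) ^ 2 *
    (Nat.card (LinearMap.ker (nilForm lam)) : ℂ) * (Nat.card (U F P) : ℂ) = 1 from ?_, one_mul]
  rw [div_mul_eq_mul_div, div_mul_eq_mul_div, div_eq_one_iff_eq (pow_ne_zero _ hG), sq]
  congr 1
  rw [h2, mul_comm]

theorem superchar_eq_character (θ : AddChar F ℂ) (hθ : θ ≠ 1) (lam : NilDual F P) (g : U F P) :
    superchar θ lam g = (supercharRep θ lam).character g := by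
  classical
  have : Fintype (leftOrbit lam) := Fintype.ofFinite _
  rw [superchar_eq_sum_fixed θ hθ, supercharRep, Representation.character_monomial]
  refine Finset.sum_congr rfl fun mu _ => ?_
  by_cases h : leftAct g mu.1 = mu.1
  · rw [if_pos h, if_pos (Subtype.ext h), h]
  · rw [if_neg h, if_neg fun h' => h (congrArg Subtype.val h')]

theorem superchar_inv_eq_sum (θ : AddChar F ℂ) (lam : NilDual F P) (g : U F P) :
    superchar θ lam g⁻¹ = ((leftOrbit lam).ncard : ℂ) / (Nat.card (U F P) : ℂ) ^ 2 *
      ∑ p, θ (- translate lam p (subOne g)) := by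
  rw [superchar_eq_sum]
  congr 1
  -- Since `g⁻¹ - 1 = -g⁻¹(g - 1)`, the extra `g⁻¹` is absorbed into the left factor.
  refine Fintype.sum_equiv ((Equiv.mulRight g⁻¹).prodCongr (Equiv.refl _)) _ _ fun p => ?_
  simp [translate, subOne_inv, mulLeft_mul, mulLeft_mulRight]

/-- Expand into a sum over two pairs `p, q`. The sum over `g` is `|U_P|` when the two translates of
`λ` agree and 0 otherwise; there are `|U_P|²` choices of `p`, each with the same number of matching
`q`. -/
theorem sum_superchar_mul_superchar_inv (θ : AddChar F ℂ) (hθ : θ ≠ 1) (lam : NilDual F P) :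
    ∑ g, superchar θ lam g * superchar θ lam g⁻¹ =
      (((leftOrbit lam).ncard : ℂ) / (Nat.card (U F P) : ℂ) ^ 2) ^ 2 *
      ((Nat.card (U F P) : ℂ) ^ 3 *
      Nat.card {p : nil F P × nil F P // ∀ X, lam (nilMul p.1 X) = lam (nilMul X p.2)}) := by
  classical
  have : Fintype (nil F P) := Fintype.ofFinite _
  have h1 : ∀ g, superchar θ lam g * superchar θ lam g⁻¹ =
      (((leftOrbit lam).ncard : ℂ) / (Nat.card (U F P) : ℂ) ^ 2) ^ 2 *
      ∑ p, ∑ q, θ ((translate lam p - translate lam q) (subOne g)) := by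
    intro g
    rw [superchar_eq_sum, superchar_inv_eq_sum, mul_mul_mul_comm, ← sq, Finset.sum_mul_sum]
    congr 1
    refine Finset.sum_congr rfl fun p _ => Finset.sum_congr rfl fun q _ => ?_
    rw [← AddChar.map_add_eq_mul, LinearMap.sub_apply, sub_eq_add_neg]
  simp only [h1]
  rw [← Finset.mul_sum, Finset.sum_comm]
  congr 1
  have h2 : ∀ p : U F P × U F P,
      ∑ g, ∑ q, θ ((translate lam p - translate lam q) (subOne g)) =
      (Nat.card (U F P) : ℂ) *
      Nat.card {p : nil F P × nil F P // ∀ X, lam (nilMul p.1 X) = lam (nilMul X p.2)} := by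
    intro p
    rw [Finset.sum_comm]
    have h3 : ∀ q, ∑ g, θ ((translate lam p - translate lam q) (subOne g)) =
        if translate lam q = translate lam p then (Nat.card (U F P) : ℂ) else 0 := by
      intro q
      rw [Function.Bijective.sum_comp subOne_bijective
        (fun Z => θ ((translate lam p - translate lam q) Z)), sum_addChar_dual θ hθ, card_U]
      exact if_congr (sub_eq_zero.trans eq_comm) rfl rfl
    simp only [h3]
    rw [← card_fiber_translate lam p, ← Finset.sum_filter, Finset.sum_const, nsmul_eq_mul,
      mul_comm, Nat.card_eq_fintype_card (α := {p' // translate lam p' = translate lam p}),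
      Fintype.card_subtype]
  simp only [h2]
  rw [Finset.sum_const, Finset.card_univ, nsmul_eq_mul, ← Nat.card_eq_fintype_card, Nat.card_prod]
  push_cast
  ring

end Group

theorem isIrreducibleCharacter_superchar_iff {F : Type*} [Field F] [Finite F] {n : ℕ}
    {P : PatternPoset n} (θ : AddChar F ℂ) (hθ : θ ≠ 1)
    (lam : NilDual F P) :
    IsIrreducibleCharacter (superchar θ lam) ↔ TrivialIntersection lam := by
  have : Fintype (U F P) := Fintype.ofFinite _
  rw [isIrreducibleCharacter_iff_sum _ (supercharRep θ lam) (superchar_eq_character θ hθ lam),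
    sum_superchar_mul_superchar_inv θ hθ, ← card_eq_sq_iff_trivialIntersection]
  have hG : (Nat.card (U F P) : ℂ) ≠ 0 := by simp
  have h := card_U_eq_mul_leftOrbit lam
  have h3 := hG
  rw [h] at h3
  have h4 := left_ne_zero_of_mul h3
  have h5 := right_ne_zero_of_mul h3
  rw [← Nat.cast_inj (R := ℂ), Nat.cast_pow, h]
  generalize (Nat.card (LinearMap.ker (nilForm lam)) : ℂ) = N at *
  generalize ((leftOrbit lam).ncard : ℂ) = L at *
  generalize (Nat.card {p : nil F P × nil F P //
    ∀ X, lam (nilMul p.1 X) = lam (nilMul X p.2)} : ℂ) = K at *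
  -- With `|U_P| = NL`, the norm condition reads `(L / N) K = NL`, i.e. `K = N²`.
  have h6 : (L / (N * L) ^ 2) ^ 2 * ((N * L) ^ 3 * K) = L / N * K := by
    field_simp
  rw [h6, div_mul_eq_mul_div, div_eq_iff h4]
  constructor
  · intro h7
    exact mul_left_cancel₀ h5 (by linear_combination h7)
  · intro h7
    linear_combination L * h7

end PatternGroup

namespace PatternGroup

/-! ### Matrix entries and crossings -/

section Entries

variable {F : Type*} [Field F] {n : ℕ} {P : PatternPoset n}

theorem apply_elem (lam : NilDual F P) {i j : Fin n} (h : (i, j) ∈ P.carrier) :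
    lam (elem F h) = entry lam i j := by
  rw [entry, dif_pos h]

theorem entry_of_notMem (lam : NilDual F P) {i j : Fin n} (h : (i, j) ∉ P.carrier) :
    entry lam i j = 0 := by
  rw [entry, dif_neg h]

theorem mem_of_mem_supp {lam : NilDual F P} {i j : Fin n} (h : (i, j) ∈ supp lam) :
    (i, j) ∈ P.carrier := by
  by_contra h'
  exact h (entry_of_notMem lam h')

theorem nilDual_ext {lam mu : NilDual F P}
    (h : ∀ i j (hij : (i, j) ∈ P.carrier), lam (elem F hij) = mu (elem F hij)) : lam = mu := by
  classical
  ext1 X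
  have hX : X = ∑ i, ∑ j, if hij : (i, j) ∈ P.carrier then X.1 i j • elem F hij else 0 := by
    ext a b
    rw [Submodule.coe_sum, Matrix.sum_apply, Finset.sum_eq_single a, Submodule.coe_sum,
      Matrix.sum_apply, Finset.sum_eq_single b]
    · split_ifs with hab
      · simp [elem]
      · by_contra h0
        exact hab (X.2 a b h0)
    · intro j _ hj
      split_ifs
      · simp [elem, hj]
      · rfl
    · simp
    · intro i _ hi
      rw [Submodule.coe_sum, Matrix.sum_apply]
      refine Finset.sum_eq_zero fun j _ => ?_
      split_ifs
      · simp [elem, hi]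
      · rfl
    · simp
  rw [hX]
  simp only [map_sum]
  refine Finset.sum_congr rfl fun i _ => Finset.sum_congr rfl fun j _ => ?_
  split_ifs with hij
  · rw [map_smul, map_smul, h]
  · rw [map_zero, map_zero]

theorem apply_eq_sum (lam : NilDual F P) (X : nil F P) :
    lam X = ∑ i, ∑ j, entry lam i j * X.1 i j := by
  have : lam = ofEntries P (entry lam) := nilDual_ext fun i j hij => by
    rw [apply_elem, apply_elem, entry_ofEntries _ hij]
  conv_lhs => rw [this]
  rfl

theorem apply_nilMul_elem (lam : NilDual F P) (Y : nil F P) {j k : Fin n}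
    (h : (j, k) ∈ P.carrier) :
    lam (nilMul Y (elem F h)) = ∑ i, entry lam i k * Y.1 i j := by
  rw [apply_eq_sum]
  refine Finset.sum_congr rfl fun i _ => ?_
  rw [Finset.sum_eq_single k]
  · simp [coe_nilMul, elem]
  · intro l _ hl
    simp [coe_nilMul, elem, Matrix.mul_single_apply_of_ne _ _ _ _ _ hl]
  · simp

theorem apply_elem_nilMul (lam : NilDual F P) (Z : nil F P) {j k : Fin n}
    (h : (j, k) ∈ P.carrier) :
    lam (nilMul (elem F h) Z) = ∑ l, entry lam j l * Z.1 k l := by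
  rw [apply_eq_sum, Finset.sum_eq_single j]
  · refine Finset.sum_congr rfl fun l _ => ?_
    simp [coe_nilMul, elem]
  · intro i _ hi
    refine Finset.sum_eq_zero fun l _ => ?_
    simp [coe_nilMul, elem, Matrix.single_mul_apply_of_ne _ _ _ _ _ hi]
  · simp

/-- `(i, j), (j, k), (k, l) ∈ P` whenever `(i, k)` and `(j, l)` cross. -/
def HasCrossing (lam : NilDual F P) : Prop :=
  ∃ i j k l : Fin n, (i, k) ∈ supp lam ∧ (j, l) ∈ supp lam ∧
    (i, j) ∈ P.carrier ∧ (j, k) ∈ P.carrier ∧ (k, l) ∈ P.carrier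

theorem trivialIntersection_iff_not_hasCrossing {lam : NilDual F P}
    (hlam : IsLabeledSetPartition lam) : TrivialIntersection lam ↔ ¬ HasCrossing lam := by
  constructor
  · rintro h ⟨i, j, k, l, hik, hjl, hij, hjk, hkl⟩
    -- Row `i` of `λ` has its only nonzero entry at `k`, and column `l` has its only one at `j`.
    -- Hence both products are multiples of the same coordinate `X_{jk}`; rescaling makes them
    -- equal.
    have hY : ∀ X, lam (nilMul (elem F hij) X) = entry lam i k * X.1 j k := by
      intro X
      rw [apply_elem_nilMul, Finset.sum_eq_single k]
      · intro m _ hm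
        have : entry lam i m = 0 := by
          by_contra h0
          exact hm (hlam.1 i m k h0 hik)
        rw [this, zero_mul]
      · simp
    have hZ : ∀ X, lam (nilMul X (elem F hkl)) = entry lam j l * X.1 j k := by
      intro X
      rw [apply_nilMul_elem, Finset.sum_eq_single j]
      · intro m _ hm
        have : entry lam m l = 0 := by
          by_contra h0
          exact hm (hlam.2 m j l h0 hjl)
        rw [this, zero_mul]
      · simp
    have hik' : entry lam i k ≠ 0 := hik
    have hjl' : entry lam j l ≠ 0 := hjl
    have h0 := h ((entry lam i k)⁻¹ • elem F hij) ((entry lam j l)⁻¹ • elem F hkl)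
      (fun X => by
        rw [map_smul, map_smul, LinearMap.smul_apply, map_smul, map_smul, hY, hZ, smul_eq_mul,
          smul_eq_mul, inv_mul_cancel_left₀ hik', inv_mul_cancel_left₀ hjl']) (elem F hjk)
    rw [map_smul, LinearMap.smul_apply, map_smul, hY, smul_eq_mul,
      inv_mul_cancel_left₀ hik'] at h0
    simp [elem] at h0
  · intro hnc Y Z hYZ
    suffices nilForm lam Y = 0 from LinearMap.congr_fun this
    refine nilDual_ext fun j k hjk => ?_
    rw [LinearMap.zero_apply]
    by_contra h0
    have h1 := h0
    -- The common functional is nonzero at `e_{jk}`; expanding it through `Y` produces `i`, and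
    -- through `Z` produces `l`.
    rw [nilForm_apply, apply_nilMul_elem] at h0
    rw [nilForm_apply, hYZ, apply_elem_nilMul] at h1
    obtain ⟨i, -, hi⟩ := Finset.exists_ne_zero_of_sum_ne_zero h0
    obtain ⟨l, -, hl⟩ := Finset.exists_ne_zero_of_sum_ne_zero h1
    exact hnc ⟨i, j, k, l, left_ne_zero_of_mul hi, left_ne_zero_of_mul hl,
      Y.2 _ _ (right_ne_zero_of_mul hi), hjk, Z.2 _ _ (right_ne_zero_of_mul hl)⟩

theorem entry_restrictTo_ne_zero {S : Set (Fin n × Fin n)} {eta : NilDual F P} {i j : Fin n}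
    (h : entry (restrictTo S eta) i j ≠ 0) : (i, j) ∈ S := by
  have hij : (i, j) ∈ P.carrier := mem_of_mem_supp h
  rw [restrictTo, entry_ofEntries _ hij] at h
  by_contra hS
  exact h (if_neg hS)

end Entries

/-! ### Twisting by the full unitriangular group -/

section Twist

variable {F : Type*} [Field F] [Finite F] {n : ℕ} {P : PatternPoset n}

theorem le_of_apply_ne_zero (g : U F P) {i j : Fin n} (h : g.1.1 i j ≠ 0) : i ≤ j := by
  by_contra hij
  have h1 := g.2 i j
  rw [Matrix.sub_apply, Matrix.one_apply_ne (not_le.1 hij).ne', sub_zero] at h1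
  exact hij (P.lt_of_mem _ _ (h1 h)).le

/-- The `(i, l)` entry involves only `X_{jk}` with `i ≤ j` and `k ≤ l`, which is the shape of the
normality condition. -/
theorem mul_mul_mem_nil (hP : P.IsNormal) (a b : U F (PatternPoset.full n)) (X : nil F P) :
    a.1.1 * X.1 * b.1.1 ∈ nil F P := by
  intro i l h
  rw [Matrix.mul_apply] at h
  obtain ⟨k, -, hk⟩ := Finset.exists_ne_zero_of_sum_ne_zero h
  have h1 := left_ne_zero_of_mul hk
  rw [Matrix.mul_apply] at h1
  obtain ⟨j, -, hj⟩ := Finset.exists_ne_zero_of_sum_ne_zero h1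
  have hX := X.2 _ _ (right_ne_zero_of_mul hj)
  exact hP i j k l (le_of_apply_ne_zero a (left_ne_zero_of_mul hj)) (P.lt_of_mem _ _ hX)
    (le_of_apply_ne_zero b (right_ne_zero_of_mul hk)) hX

/-- The action `X ↦ a X b` of the full unitriangular group on `𝔫_P`, for `P ⊴ [[n]]`. -/
def twist (hP : P.IsNormal) (a b : U F (PatternPoset.full n)) (X : nil F P) : nil F P :=
  ⟨a.1.1 * X.1 * b.1.1, mul_mul_mem_nil hP a b X⟩

theorem inv_mul_val (a : U F P) : (a⁻¹).1.1 * a.1.1 = 1 := Units.inv_mul a.1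

theorem mul_inv_val (a : U F P) : a.1.1 * (a⁻¹).1.1 = 1 := Units.mul_inv a.1

/-- Substituting `X = a⁻¹X'b⁻¹` turns a pair `(Y, Z)` for `μ` into the pair `(aYa⁻¹, b⁻¹Zb)` for
`λ`. -/
theorem TrivialIntersection.of_twist {hP : P.IsNormal} {a b : U F (PatternPoset.full n)}
    {lam mu : NilDual F P} (hmu : ∀ X, mu X = lam (twist hP a b X))
    (h : TrivialIntersection lam) : TrivialIntersection mu := by
  intro Y Z hYZ X
  have h1 : ∀ X', lam (nilMul (twist hP a a⁻¹ Y) X') = lam (nilMul X' (twist hP b⁻¹ b Z)) := by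
    intro X'
    have h2 := hYZ (twist hP a⁻¹ b⁻¹ X')
    rw [hmu, hmu] at h2
    convert h2 using 2
    · ext1
      change a.1.1 * Y.1 * (a⁻¹).1.1 * X'.1 =
        a.1.1 * (Y.1 * ((a⁻¹).1.1 * X'.1 * (b⁻¹).1.1)) * b.1.1
      simp only [Matrix.mul_assoc, inv_mul_val, Matrix.mul_one]
    · ext1
      change X'.1 * ((b⁻¹).1.1 * Z.1 * b.1.1) =
        a.1.1 * (((a⁻¹).1.1 * X'.1 * (b⁻¹).1.1) * Z.1) * b.1.1
      simp only [← Matrix.mul_assoc, mul_inv_val, Matrix.one_mul]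
  have h3 := h _ _ h1 (twist hP a b X)
  rw [hmu, ← h3]
  congr 1
  ext1
  change a.1.1 * (Y.1 * X.1) * b.1.1 =
    a.1.1 * Y.1 * (a⁻¹).1.1 * (a.1.1 * X.1 * b.1.1)
  simp only [Matrix.mul_assoc]
  rw [← Matrix.mul_assoc (a⁻¹).1.1, inv_mul_val, Matrix.one_mul]

theorem trivialIntersection_iff_of_twist {hP : P.IsNormal} {a b : U F (PatternPoset.full n)}
    {lam mu : NilDual F P} (hmu : ∀ X, mu X = lam (twist hP a b X)) :
    TrivialIntersection mu ↔ TrivialIntersection lam := by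
  refine ⟨TrivialIntersection.of_twist (hP := hP) (a := a⁻¹) (b := b⁻¹) fun X => ?_,
    TrivialIntersection.of_twist hmu⟩
  rw [hmu]
  congr 1
  ext1
  change X.1 = a.1.1 * ((a⁻¹).1.1 * X.1 * (b⁻¹).1.1) * b.1.1
  rw [← Matrix.mul_assoc, ← Matrix.mul_assoc, mul_inv_val, Matrix.one_mul, Matrix.mul_assoc,
    inv_mul_val, Matrix.mul_one]

theorem apply_twist_elem (hP : P.IsNormal) (a b : U F (PatternPoset.full n)) (lam : NilDual F P)
    {j k : Fin n} (h : (j, k) ∈ P.carrier) :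
    lam (twist hP a b (elem F h)) =
      ∑ i, ∑ l, entry lam i l * (a.1.1 i j * b.1.1 k l) := by
  rw [apply_eq_sum]
  refine Finset.sum_congr rfl fun i _ => Finset.sum_congr rfl fun l _ => ?_
  congr 1
  change (a.1.1 * (Matrix.single j k 1 : Matrix (Fin n) (Fin n) F) * b.1.1) i l = _
  rw [Matrix.mul_apply, Finset.sum_eq_single k]
  · simp
  · intro m _ hm
    simp [hm]
  · simp

open Classical in
-- The entries are chosen so that `λ_{il} a_{ij} = η_{jl}` for `i < j`. Each row of `λ` has at most
-- one support position, so `i` determines `l` and the sum defining `N` has at most one term.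
theorem exists_left_factor {lam : NilDual F P} (hlam : IsLabeledSetPartition lam)
    (eta : NilDual F P) : ∃ a : U F (PatternPoset.full n), ∀ i l, (i, l) ∈ supp lam → ∀ j,
      a.1.1 i j = (if i = j then 1 else 0) +
        if i < j then entry eta j l * (entry lam i l)⁻¹ else 0 := by
  let N : Matrix (Fin n) (Fin n) F := fun i j => if i < j then
    ∑ l, if (i, l) ∈ supp lam then entry eta j l * (entry lam i l)⁻¹ else 0 else 0
  have hN : N ∈ nil F (PatternPoset.full n) := by
    intro i j h
    by_contra hij
    exact h (if_neg hij)
  obtain ⟨a, ha⟩ := (subOne_bijective (F := F) (P := PatternPoset.full n)).2 ⟨N, hN⟩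
  have ha' : a.1.1 = 1 + N := by
    have : a.1.1 - 1 = N := congrArg Subtype.val ha
    rw [← this, add_sub_cancel]
  refine ⟨a, fun i l hil j => ?_⟩
  rw [ha', Matrix.add_apply, Matrix.one_apply]
  congr 1
  refine if_congr Iff.rfl ?_ rfl
  rw [Finset.sum_eq_single l, if_pos hil]
  · intro m _ hm
    exact if_neg fun h => hm (hlam.1 i m l h hil)
  · simp

open Classical in
theorem exists_right_factor {lam : NilDual F P} (hlam : IsLabeledSetPartition lam)
    (eta : NilDual F P) : ∃ b : U F (PatternPoset.full n), ∀ i l, (i, l) ∈ supp lam → ∀ k,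
      b.1.1 k l = (if k = l then 1 else 0) +
        if k < l then entry eta i k * (entry lam i l)⁻¹ else 0 := by
  let N : Matrix (Fin n) (Fin n) F := fun k l => if k < l then
    ∑ i, if (i, l) ∈ supp lam then entry eta i k * (entry lam i l)⁻¹ else 0 else 0
  have hN : N ∈ nil F (PatternPoset.full n) := by
    intro i j h
    by_contra hij
    exact h (if_neg hij)
  obtain ⟨b, hb⟩ := (subOne_bijective (F := F) (P := PatternPoset.full n)).2 ⟨N, hN⟩
  have hb' : b.1.1 = 1 + N := by
    have : b.1.1 - 1 = N := congrArg Subtype.val hb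
    rw [← this, add_sub_cancel]
  refine ⟨b, fun i l hil k => ?_⟩
  rw [hb', Matrix.add_apply, Matrix.one_apply]
  congr 1
  refine if_congr Iff.rfl ?_ rfl
  rw [Finset.sum_eq_single i, if_pos hil]
  · intro m _ hm
    exact if_neg fun h => hm (hlam.2 m i l h hil)
  · simp

theorem exists_twist_eq_add_starProd (hP : P.IsNormal) {lam : NilDual F P}
    (hlam : IsLabeledSetPartition lam) {eta mu : NilDual F P}
    (heta : ∀ j k, entry eta j k ≠ 0 → ∃ i, (i, k) ∈ supp lam ∧ i < j)
    (hmu : ∀ j k, entry mu j k ≠ 0 → ∃ l, (j, l) ∈ supp lam ∧ k < l) :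
    ∃ a b : U F (PatternPoset.full n), ∀ X,
      (lam + starProd lam eta mu) X = lam (twist hP a b X) := by
  classical
  obtain ⟨a, ha⟩ := exists_left_factor hlam eta
  obtain ⟨b, hb⟩ := exists_right_factor hlam mu
  refine ⟨a, b, fun X => ?_⟩
  let tw : nil F P →ₗ[F] nil F P :=
    { toFun := twist hP a b
      map_add' := fun Y Z => Subtype.ext (by
        change a.1.1 * (Y.1 + Z.1) * b.1.1 = a.1.1 * Y.1 * b.1.1 + a.1.1 * Z.1 * b.1.1
        rw [Matrix.mul_add, Matrix.add_mul])
      map_smul' := fun c Y => Subtype.ext (by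
        change a.1.1 * (c • Y.1) * b.1.1 = c • (a.1.1 * Y.1 * b.1.1)
        rw [Matrix.mul_smul, Matrix.smul_mul]) }
  suffices lam + starProd lam eta mu = lam ∘ₗ tw from LinearMap.congr_fun this X
  refine nilDual_ext fun j k hjk => ?_
  have hjk' := P.lt_of_mem _ _ hjk
  change _ = lam (twist hP a b (elem F hjk))
  rw [apply_twist_elem, LinearMap.add_apply, apply_elem, apply_elem, starProd,
    entry_ofEntries _ hjk]
  -- Each of `a`, `b` is identity plus strictly upper part; the four products give the terms `λ`,
  -- `η`, `μ` and the correction sum of `*_λ`.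
  have hterm : ∀ i l, entry lam i l * (a.1.1 i j * b.1.1 k l) =
      (if i = j then (if k = l then entry lam i l else 0) else 0) +
      (if k = l then (if i < j ∧ (i, l) ∈ supp lam then entry eta j l else 0) else 0) +
      (if i = j then (if k < l ∧ (i, l) ∈ supp lam then entry mu i k else 0) else 0) +
      (if i < j ∧ j < k ∧ k < l ∧ (i, l) ∈ supp lam then
        entry eta j l * entry mu i k * (entry lam i l)⁻¹ else 0) := by
    intro i l
    by_cases hil : (i, l) ∈ supp lam
    · have h0 : entry lam i l ≠ 0 := hil
      rw [ha i l hil, hb i l hil]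
      simp only [hil, hjk', and_true, true_and]
      by_cases h1 : i = j <;> by_cases h2 : k = l
      · subst h1 h2
        simp
      · subst h1
        by_cases h3 : k < l
        · simp [h2, h3]
          field_simp
        · simp [h2, h3]
      · subst h2
        by_cases h3 : i < j
        · simp [h1, h3]
          field_simp
        · simp [h1, h3]
      · by_cases h3 : k < l <;> by_cases h4 : i < j
        · simp [h1, h2, h3, h4]
          field_simp
        all_goals simp [h1, h2, h3, h4]
    · have h0 : entry lam i l = 0 := not_not.1 hil
      simp [hil, h0]
  simp only [hterm, Finset.sum_add_distrib]
  have s1 : ∑ i, ∑ l, (if i = j then (if k = l then entry lam i l else 0) else 0) =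
      entry lam j k := by
    rw [Finset.sum_eq_single j]
    · simp
    · intro i _ hi
      simp [hi]
    · simp
  -- `heta` ensures that every nonzero `η_{jk}` is picked up, and column uniqueness that it is
  -- picked up only once.
  have s2 : ∑ i, ∑ l, (if k = l then (if i < j ∧ (i, l) ∈ supp lam then entry eta j l else 0)
      else 0) = entry eta j k := by
    simp only [Finset.sum_ite_eq, Finset.mem_univ, if_true]
    by_cases h0 : entry eta j k = 0
    · simp [h0]
    · obtain ⟨i, hi, hij⟩ := heta j k h0
      rw [Finset.sum_eq_single i, if_pos ⟨hij, hi⟩]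
      · intro m _ hm
        exact if_neg fun h => hm (hlam.2 m i k h.2 hi)
      · simp
  have s3 : ∑ i, ∑ l, (if i = j then (if k < l ∧ (i, l) ∈ supp lam then entry mu i k else 0)
      else 0) = entry mu j k := by
    rw [Finset.sum_comm]
    simp only [Finset.sum_ite_eq', Finset.mem_univ, if_true]
    by_cases h0 : entry mu j k = 0
    · simp [h0]
    · obtain ⟨l, hl, hkl⟩ := hmu j k h0
      rw [Finset.sum_eq_single l, if_pos ⟨hkl, hl⟩]
      · intro m _ hm
        exact if_neg fun h => hm (hlam.1 j m l h.2 hl)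
      · simp
  rw [s1, s2, s3]
  ring

theorem trivialIntersection_add_rMap_iff (hP : P.IsNormal) {lam : NilDual F P}
    (hlam : IsLabeledSetPartition lam) (eta : NilDual F P) :
    TrivialIntersection (lam + rMap lam eta) ↔ TrivialIntersection lam := by
  obtain ⟨a, b, h⟩ := exists_twist_eq_add_starProd hP hlam
    (eta := restrictTo (coauxL lam) eta) (mu := restrictTo (coauxR lam \ coauxL lam) eta)
    (fun j k hjk => (entry_restrictTo_ne_zero hjk).1.2)
    (fun j k hjk => (entry_restrictTo_ne_zero hjk).1.1.2)
  exact trivialIntersection_iff_of_twist h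

end Twist

end PatternGroup

/-! ### Chords of the unit circle -/

namespace PatternGroup

open Complex

/-- A real affine functional vanishing on the line through `exp(iα)` and `exp(iβ)`. -/
noncomputable def chordSide (α β : ℝ) (z : ℂ) : ℝ :=
  z.re * Real.cos ((α + β) / 2) + z.im * Real.sin ((α + β) / 2) - Real.cos ((β - α) / 2)

theorem chordSide_combo (α β : ℝ) {s t : ℝ} (hst : s + t = 1) (z w : ℂ) :
    chordSide α β (s • z + t • w) = s * chordSide α β z + t * chordSide α β w := by
  simp only [chordSide, add_re, add_im, real_smul, re_ofReal_mul, im_ofReal_mul]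
  linear_combination Real.cos ((β - α) / 2) * hst

/-- The sign on the circle thus compares the angular distance of `γ` from the midpoint of the arc
with the half-width of the arc. -/
theorem chordSide_exp (α β γ : ℝ) :
    chordSide α β (exp (γ * I)) = Real.cos (γ - (α + β) / 2) - Real.cos ((β - α) / 2) := by
  rw [chordSide, exp_ofReal_mul_I_re, exp_ofReal_mul_I_im, Real.cos_sub γ]

theorem chordSide_exp_left (α β : ℝ) : chordSide α β (exp (α * I)) = 0 := by
  rw [chordSide_exp, sub_eq_zero, ← Real.cos_neg]
  congr 1
  ring

theorem chordSide_exp_right (α β : ℝ) : chordSide α β (exp (β * I)) = 0 := by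
  rw [chordSide_exp, sub_eq_zero]
  congr 1
  ring

theorem chordSide_exp_pos {α β γ : ℝ} (hα : 0 ≤ α) (hβ : β < 2 * Real.pi) (h1 : α < γ)
    (h2 : γ < β) : 0 < chordSide α β (exp (γ * I)) := by
  rw [chordSide_exp, sub_pos, ← Real.cos_abs (γ - (α + β) / 2)]
  refine Real.cos_lt_cos_of_nonneg_of_le_pi (abs_nonneg _) (by linarith) ?_
  rw [abs_lt]
  constructor <;> linarith

theorem chordSide_exp_neg {α β γ : ℝ} (hα : 0 ≤ α) (hβ : β < 2 * Real.pi) (hαβ : α < β)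
    (hγ0 : 0 ≤ γ) (hγ : γ < 2 * Real.pi) (h : γ < α ∨ β < γ) :
    chordSide α β (exp (γ * I)) < 0 := by
  rw [chordSide_exp, sub_neg, ← Real.cos_abs (γ - (α + β) / 2)]
  have hd : (β - α) / 2 < |γ - (α + β) / 2| := by
    rw [lt_abs]
    rcases h with h | h
    · right; linarith
    · left; linarith
  have hu : |γ - (α + β) / 2| ≤ 2 * Real.pi - (β - α) / 2 := by
    rw [abs_le]
    constructor <;> linarith
  -- Cosine decreases only on `[0, π]`, so a distance `u > π` is replaced by `2π - u`, which still
  -- exceeds the half-width. The boundary case `u = 2π - (β - α)/2` would mean `γ = α + 2π` or `γ =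
  -- β - 2π`.
  rcases le_or_gt |γ - (α + β) / 2| Real.pi with hle | hgt
  · exact Real.cos_lt_cos_of_nonneg_of_le_pi (by linarith) hle hd
  · rw [← Real.cos_two_pi_sub]
    refine Real.cos_lt_cos_of_nonneg_of_le_pi (by linarith) (by linarith) ?_
    rcases hu.lt_or_eq with hu | hu
    · linarith
    · exfalso
      rw [eq_comm, ← sub_eq_zero] at hu
      rcases abs_cases (γ - (α + β) / 2) with ⟨h3, -⟩ | ⟨h3, -⟩ <;> linarith

theorem mem_segment_of_chordSide_eq_zero {α β : ℝ} (hα : 0 ≤ α) (hβ : β < 2 * Real.pi)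
    (hαβ : α < β) {z : ℂ} (hz : chordSide α β z = 0) (hz1 : ‖z‖ ≤ 1) :
    z ∈ segment ℝ (exp (α * I)) (exp (β * I)) := by
  set m := (α + β) / 2 with hm
  set d := (β - α) / 2 with hd
  have hsin : 0 < Real.sin d := Real.sin_pos_of_pos_of_lt_pi (by linarith) (by linarith)
  -- In coordinates rotated by `m` the line is `x = cos d` and `y` runs along it; the disc condition
  -- becomes `|y| ≤ sin d`, which gives nonnegative weights `(sin d ∓ y) / (2 sin d)`.
  set y := z.im * Real.cos m - z.re * Real.sin m with hy
  have hx : z.re * Real.cos m + z.im * Real.sin m = Real.cos d := sub_eq_zero.1 hz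
  have hn : z.re ^ 2 + z.im ^ 2 ≤ 1 := by
    have := Complex.sq_norm z
    rw [Complex.normSq_apply] at this
    nlinarith [norm_nonneg z]
  have hre : z.re = Real.cos d * Real.cos m - y * Real.sin m := by
    rw [← hx, hy]
    linear_combination (- z.re) * Real.sin_sq_add_cos_sq m
  have him : z.im = Real.cos d * Real.sin m + y * Real.cos m := by
    rw [← hx, hy]
    linear_combination (- z.im) * Real.sin_sq_add_cos_sq m
  have hy2 : y ^ 2 ≤ Real.sin d ^ 2 := by
    have h1 : z.re ^ 2 + z.im ^ 2 = Real.cos d ^ 2 + y ^ 2 := by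
      rw [hre, him]
      linear_combination (Real.cos d ^ 2 + y ^ 2) * Real.sin_sq_add_cos_sq m
    have := Real.sin_sq_add_cos_sq d
    linarith
  obtain ⟨hy3, hy4⟩ := abs_le.1 (abs_le_of_sq_le_sq hy2 hsin.le)
  have hαe : α = m - d := by rw [hm, hd]; ring
  have hβe : β = m + d := by rw [hm, hd]; ring
  refine ⟨(Real.sin d - y) / (2 * Real.sin d), (Real.sin d + y) / (2 * Real.sin d),
    div_nonneg (by linarith) (by linarith), div_nonneg (by linarith) (by linarith),
    by field_simp; ring, ?_⟩
  apply Complex.ext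
  · rw [add_re, real_smul, real_smul, re_ofReal_mul, re_ofReal_mul, exp_ofReal_mul_I_re,
      exp_ofReal_mul_I_re, hre, hαe, hβe, Real.cos_sub, Real.cos_add]
    field_simp
    ring
  · rw [add_im, real_smul, real_smul, im_ofReal_mul, im_ofReal_mul, exp_ofReal_mul_I_im,
      exp_ofReal_mul_I_im, him, hαe, hβe, Real.sin_sub, Real.sin_add]
    field_simp
    ring

/-- The points at `γ` and `δ` lie strictly on opposite sides of the first chord, so `chordSide`
vanishes at a proper convex combination of them. Strict convexity puts that point in the open disc,
hence on the first chord itself. -/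
theorem chord_inter_nonempty {α β γ δ : ℝ} (h0 : 0 ≤ α) (h1 : α < γ) (h2 : γ < β) (h3 : β < δ)
    (h4 : δ < 2 * Real.pi) :
    (segment ℝ (exp (α * I)) (exp (β * I)) ∩ segment ℝ (exp (γ * I)) (exp (δ * I)) ∩
      Metric.ball (0 : ℂ) 1).Nonempty := by
  have hpos := chordSide_exp_pos h0 (h3.trans h4) h1 h2
  have hneg := chordSide_exp_neg h0 (h3.trans h4) (h1.trans h2) (γ := δ) (by linarith) h4
    (Or.inr h3)
  set p := chordSide α β (exp (γ * I))
  set q := chordSide α β (exp (δ * I))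
  have hpq : 0 < p - q := by linarith
  have hs : 0 < - q / (p - q) := div_pos (by linarith) hpq
  have ht : 0 < p / (p - q) := div_pos hpos hpq
  have hst : - q / (p - q) + p / (p - q) = 1 := by
    field_simp
    ring
  set z : ℂ := (- q / (p - q)) • exp (γ * I) + (p / (p - q)) • exp (δ * I) with hz
  have hz0 : chordSide α β z = 0 := by
    rw [hz, chordSide_combo _ _ hst]
    change - q / (p - q) * p + p / (p - q) * q = 0
    field_simp
    ring
  have hne : exp (γ * I) ≠ exp (δ * I) := by
    intro h
    have : p = q := congrArg (chordSide α β) h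
    linarith
  have hball : z ∈ Metric.ball (0 : ℂ) 1 :=
    combo_mem_ball_of_ne (by simp [norm_exp_ofReal_mul_I]) (by simp [norm_exp_ofReal_mul_I])
      hne hs ht hst
  exact ⟨z, ⟨mem_segment_of_chordSide_eq_zero h0 (h3.trans h4) (h1.trans h2) hz0
    (by simpa using (Metric.mem_ball.1 hball).le), _, _, hs.le, ht.le, hst, rfl⟩, hball⟩

/-- The factor `σ` (used as `±1`) selects the side. If both endpoints are weakly on one side and not
both on the line, only an endpoint can lie on the line, and endpoints have norm 1. -/
theorem not_mem_ball_of_side {α β γ δ : ℝ} {z : ℂ} {σ : ℝ}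
    (h1 : 0 ≤ σ * chordSide α β (exp (γ * I))) (h2 : 0 ≤ σ * chordSide α β (exp (δ * I)))
    (h3 : σ * chordSide α β (exp (γ * I)) ≠ 0 ∨ σ * chordSide α β (exp (δ * I)) ≠ 0)
    (hz : chordSide α β z = 0) (hz' : z ∈ segment ℝ (exp (γ * I)) (exp (δ * I))) :
    z ∉ Metric.ball (0 : ℂ) 1 := by
  obtain ⟨s, t, hs, ht, hst, rfl⟩ := hz'
  rw [chordSide_combo _ _ hst] at hz
  have h4 : s * (σ * chordSide α β (exp (γ * I))) + t * (σ * chordSide α β (exp (δ * I))) = 0 := by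
    linear_combination σ * hz
  have h5 := mul_nonneg hs h1
  have h6 := mul_nonneg ht h2
  have h7 : s * (σ * chordSide α β (exp (γ * I))) = 0 := by linarith
  have h8 : t * (σ * chordSide α β (exp (δ * I))) = 0 := by linarith
  rcases h3 with h3 | h3
  · have hs0 : s = 0 := (mul_eq_zero.1 h7).resolve_right h3
    have ht1 : t = 1 := by linarith
    simp [hs0, ht1, norm_exp_ofReal_mul_I]
  · have ht0 : t = 0 := (mul_eq_zero.1 h8).resolve_right h3
    have hs1 : s = 1 := by linarith
    simp [ht0, hs1, norm_exp_ofReal_mul_I]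

theorem chordSide_eq_zero_of_mem_segment {α β : ℝ} {z : ℂ}
    (hz : z ∈ segment ℝ (exp (α * I)) (exp (β * I))) : chordSide α β z = 0 := by
  obtain ⟨s, t, hs, ht, hst, rfl⟩ := hz
  rw [chordSide_combo _ _ hst, chordSide_exp_left, chordSide_exp_right]
  ring

theorem chord_inter_eq_empty {α β γ δ : ℝ} (hα : 0 ≤ α) (hαβ : α < β) (hβ : β < 2 * Real.pi)
    (hγ : 0 ≤ γ) (hγδ : γ < δ) (hδ : δ < 2 * Real.pi) (hne : α ≠ γ ∨ β ≠ δ)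
    (h1 : ¬ (α < γ ∧ γ < β ∧ β < δ)) (h2 : ¬ (γ < α ∧ α < δ ∧ δ < β)) :
    segment ℝ (exp (α * I)) (exp (β * I)) ∩ segment ℝ (exp (γ * I)) (exp (δ * I)) ∩
      Metric.ball (0 : ℂ) 1 = ∅ := by
  rw [Set.eq_empty_iff_forall_notMem]
  rintro z ⟨⟨hz, hz'⟩, hball⟩
  have hz0 := chordSide_eq_zero_of_mem_segment hz
  revert hball
  change z ∉ _
  have sideL := chordSide_exp_left α β
  have sideR := chordSide_exp_right α β
  have inside : ∀ x, α < x → x < β → 0 < chordSide α β (exp (x * I)) :=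
    fun x => chordSide_exp_pos hα hβ
  have outside : ∀ x, 0 ≤ x → x < 2 * Real.pi → (x < α ∨ β < x) →
      chordSide α β (exp (x * I)) < 0 := fun x => chordSide_exp_neg hα hβ hαβ
  have inside' : ∀ x, α ≤ x → x ≤ β → 0 ≤ chordSide α β (exp (x * I)) := by
    intro x hx hx'
    rcases hx.eq_or_lt with rfl | hx
    · exact sideL.ge
    rcases hx'.eq_or_lt with rfl | hx'
    · exact sideR.ge
    exact (inside x hx hx').le
  have outside' : ∀ x, 0 ≤ x → x < 2 * Real.pi → (x ≤ α ∨ β ≤ x) →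
      chordSide α β (exp (x * I)) ≤ 0 := by
    rintro x hx hx' (h | h)
    · rcases h.eq_or_lt with rfl | h
      · exact sideL.le
      · exact (outside x hx hx' (Or.inl h)).le
    · rcases h.eq_or_lt with rfl | h
      · exact sideR.le
      · exact (outside x hx hx' (Or.inr h)).le
  have hγ' : γ < 2 * Real.pi := hγδ.trans hδ
  have hδ' : 0 ≤ δ := hγ.trans hγδ.le
  by_cases hin : α ≤ γ ∧ δ ≤ β
  · refine not_mem_ball_of_side (σ := 1) (by simpa using inside' γ hin.1 (hγδ.le.trans hin.2))
      (by simpa using inside' δ (hin.1.trans hγδ.le) hin.2) ?_ hz0 hz'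
    rw [one_mul, one_mul]
    rcases hin.1.eq_or_lt with h | h
    · exact Or.inr (inside δ (h.trans_lt hγδ)
        (hin.2.lt_of_ne fun h' => hne.elim (fun h'' => h'' h) (fun h'' => h'' h'.symm))).ne'
    · exact Or.inl (inside γ h (hγδ.trans_le hin.2)).ne'
  -- One endpoint strictly inside the arc and the other strictly outside would be interlacing,
  -- excluded by `h1` and `h2`; so both lie weakly outside.
  · have hout : (γ ≤ α ∨ β ≤ γ) ∧ (δ ≤ α ∨ β ≤ δ) := by
      grind
    have hstrict : (γ < α ∨ β < γ) ∨ (δ < α ∨ β < δ) := by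
      grind
    refine not_mem_ball_of_side (σ := -1) (by linarith [outside' γ hγ hγ' hout.1])
      (by linarith [outside' δ hδ' hδ hout.2]) ?_ hz0 hz'
    rcases hstrict with h | h
    · exact Or.inl (neg_one_mul (chordSide α β (exp (γ * I))) ▸ neg_pos.2 (outside γ hγ hγ' h)).ne'
    · exact Or.inr (neg_one_mul (chordSide α β (exp (δ * I))) ▸ neg_pos.2 (outside δ hδ' hδ h)).ne'

/-- The argument in `[0, 2π)` of `circlePoint m`. -/
noncomputable def circleAngle {n : ℕ} (m : Fin n) : ℝ := 2 * Real.pi * (m : ℕ) / n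

theorem circlePoint_eq {n : ℕ} (m : Fin n) : circlePoint m = exp (circleAngle m * I) := by
  rw [circlePoint, circleAngle]
  push_cast
  rfl

theorem circleAngle_nonneg {n : ℕ} (m : Fin n) : 0 ≤ circleAngle m := by
  have := Real.pi_pos
  rw [circleAngle]
  positivity

theorem circleAngle_strictMono {n : ℕ} : StrictMono (circleAngle : Fin n → ℝ) := by
  intro a b hab
  have hn : (0 : ℝ) < n := by exact_mod_cast a.pos
  have hab' : ((a : ℕ) : ℝ) < (b : ℕ) := by exact_mod_cast hab
  have := Real.pi_pos
  rw [circleAngle, circleAngle]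
  gcongr

theorem circleAngle_lt {n : ℕ} (m : Fin n) : circleAngle m < 2 * Real.pi := by
  have hn : (0 : ℝ) < n := by exact_mod_cast m.pos
  have hm : ((m : ℕ) : ℝ) < n := by exact_mod_cast m.2
  have := Real.pi_pos
  rw [circleAngle, div_lt_iff₀ hn]
  gcongr

theorem isNonCrossing_iff {n : ℕ} {S : Set (Fin n × Fin n)} (hS : ∀ p ∈ S, p.1 < p.2) :
    IsNonCrossing S ↔
      ∀ i j k l : Fin n, i < j → j < k → k < l → (i, k) ∈ S → (j, l) ∈ S → False := by
  have hmono := circleAngle_strictMono (n := n)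
  simp only [IsNonCrossing, chord, circlePoint_eq]
  constructor
  · intro h i j k l hij hjk hkl hik hjl
    have h1 := chord_inter_nonempty (circleAngle_nonneg i) (hmono hij) (hmono hjk) (hmono hkl)
      (circleAngle_lt l)
    rw [h (i, k) hik (j, l) hjl fun h => hij.ne (congrArg Prod.fst h)] at h1
    exact Set.not_nonempty_empty h1
  · rintro h ⟨i, k⟩ hik ⟨j, l⟩ hjl hne
    refine chord_inter_eq_empty (circleAngle_nonneg _) (hmono (hS _ hik)) (circleAngle_lt _)
      (circleAngle_nonneg _) (hmono (hS _ hjl)) (circleAngle_lt _) ?_ ?_ ?_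
    · by_contra! hc
      exact hne (Prod.ext (hmono.injective hc.1) (hmono.injective hc.2))
    · rintro ⟨h1, h2, h3⟩
      exact h i j k l (hmono.lt_iff_lt.1 h1) (hmono.lt_iff_lt.1 h2) (hmono.lt_iff_lt.1 h3) hik hjl
    · rintro ⟨h1, h2, h3⟩
      exact h j i l k (hmono.lt_iff_lt.1 h1) (hmono.lt_iff_lt.1 h2) (hmono.lt_iff_lt.1 h3) hjl hik

end PatternGroup

theorem mainTheorem5 {F : Type*} [Field F] [Finite F] (θ : AddChar F ℂ) (hθ : θ ≠ 1) (n : ℕ) :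
    (∀ P : PatternPoset n, P.IsNormal →
      ∀ lam eta : PatternGroup.NilDual F P,
        PatternGroup.IsLabeledSetPartition lam →
        PatternGroup.supp eta ⊆ PatternGroup.coaux lam →
        (PatternGroup.IsIrreducibleCharacter (PatternGroup.supercharPair θ lam eta) ↔
          ∀ i j k l : Fin n, i < j → j < k → k < l →
            (i, k) ∈ PatternGroup.supp lam → (j, l) ∈ PatternGroup.supp lam →
            ¬ (({(i, j), (j, k), (k, l)} : Set (Fin n × Fin n)) ⊆ P.carrier))) ∧
    (∀ lam : PatternGroup.NilDual F (PatternPoset.full n),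
      PatternGroup.IsLabeledSetPartition lam →
      (PatternGroup.IsIrreducibleCharacter (PatternGroup.superchar θ lam) ↔
        PatternGroup.IsNonCrossing (PatternGroup.supp lam))) := by
  constructor
  · intro P hP lam eta hlam _
    rw [PatternGroup.supercharPair, PatternGroup.isIrreducibleCharacter_superchar_iff θ hθ,
      PatternGroup.trivialIntersection_add_rMap_iff hP hlam,
      PatternGroup.trivialIntersection_iff_not_hasCrossing hlam]
    constructor
    · rintro h i j k l - - - hik hjl hsub
      exact h ⟨i, j, k, l, hik, hjl, hsub (by simp), hsub (by simp), hsub (by simp)⟩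
    · rintro h ⟨i, j, k, l, hik, hjl, hij, hjk, hkl⟩
      refine h i j k l (P.lt_of_mem _ _ hij) (P.lt_of_mem _ _ hjk) (P.lt_of_mem _ _ hkl) hik hjl ?_
      rintro p (rfl | rfl | rfl)
      exacts [hij, hjk, hkl]
  · intro lam hlam
    rw [PatternGroup.isIrreducibleCharacter_superchar_iff θ hθ,
      PatternGroup.trivialIntersection_iff_not_hasCrossing hlam,
      PatternGroup.isNonCrossing_iff fun p hp =>
        (PatternPoset.full n).lt_of_mem _ _ (PatternGroup.mem_of_mem_supp hp)]
    constructor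
    · intro h i j k l hij hjk hkl hik hjl
      exact h ⟨i, j, k, l, hik, hjl, hij, hjk, hkl⟩
    · rintro h ⟨i, j, k, l, hik, hjl, hij, hjk, hkl⟩
      exact h i j k l hij hjk hkl hik hjl
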